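/- Let $\mathbb F$ be a field. **Trialgebras and modules.** A multiplicative BiHom-associative trialgebra $(T,\dashv,\vdash,\perp,\alpha,\beta)$ is an $\mathbb F$-vector space with three bilinear operations and two commuting linear maps $\alpha,\beta:T\to T$ that preserve all three operations, such that for all $x,y,z\in T$ $$(x\dashv y)\dashv\beta z=\alpha x\dashv(y\dashv z)=\alpha x\dashv(y\vdash z)=\alpha x\dashv(y\perp z),\quad (x\vdash y)\dashv\beta z=\alpha x\vdash(y\dashv z),$$ $$(x\dashv y)\vdash\beta z=(x\vdash y)\vdash\beta z=(x\perp y)\vdash\beta z=\alpha x\vdash(y\vdash z),\quad (x\perp y)\dashv\beta z=\alpha x\perp(y\dashv z),$$ $$(x\dashv y)\perp\beta z=\alpha x\perp(y\vdash z),\quad (x\vdash y)\perp\beta z=\alpha x\vdash(y\perp z),\quad (x\perp y)\perp\beta z=\alpha x\perp(y\perp z).$$ A BiHom-module $(V,\alpha_V,\beta_V)$ of $T$ is a vector space with commuting linear maps $\alpha_V,\beta_V$ and bilinear maps $*:T\times V\to V$, $*:V\times T\to V$ for each $*\in\{\dashv,\vdash,\perp\}$ such that each of the eleven relations holds whenever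 exactly one of $x,y,z$ is taken in $V$ (with $\alpha_V,\beta_V$ in place of $\alpha,\beta$ on $V$), and $\alpha_V(x*v)=\alpha x*\alpha_Vv$, $\alpha_V(v*x)=\alpha_Vv*\alpha x$, and likewise for $\beta$. Associative trialgebras and their modules are the case in which all structure maps are identities. Multiplicative BiHom-associative algebras and their bimodules are the case $\dashv=\vdash=\perp$ (in the algebra and in both actions). **Trees.** Let $\mathcal T_n$ be the set of planar rooted trees with $n+1$ leaves, numbered $0,\dots,n$ from left to right, in which every internal vertex has at least two children; $|\psi|=n$ for $\psi\in\mathcal T_n$. For $0\le i\le n+1$ let $d_i:\mathcal T_{n+1}\to\mathcal T_n$ delete the $i$-th leaf (a vertex left with one child is contracted). A leaf is left-oriented (right-oriented) if it is the leftmost (rightmost) child of the vertex underneath it, and a middle leaf otherwise. For $\psi\in\mathcal T_{n+1}$, the grafting $\psi=\psi_0\vee\dots\vee\psi_k$ of the subtrees above its lowest vertex, define $\circ_i^\psi\in\{\dashv,\vdash,\perp\}$ as follows: $\circ_0^\psi$ is $\vdash$ if $|\psi_0|>0$, $\dashv$ if $|\psi_0|=0$ and $k=1$, $\perp$ if $|\psi_0|=0$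 and $k>1$; $\circ_{n+1}^\psi$ is $\dashv$ if $|\psi_k|>0$, $\vdash$ if $|\psi_k|=0$ and $k=1$, $\perp$ if $|\psi_k|=0$ and $k>1$; for $1\le i\le n$, $\circ_i^\psi$ is $\dashv$, $\vdash$, $\perp$ if the $i$-th leaf is left-oriented, right-oriented, middle, respectively. **Cochains.** For $n\ge0$ let $C^n(T,V)$ be the space of linear maps $f:\mathbb F[\mathcal T_n]\otimes T^{\otimes n}\to V$ with $\alpha_Vf(\psi;x_1,\dots,x_n)=f(\psi;\alpha x_1,\dots,\alpha x_n)$ and $\beta_Vf(\psi;x_1,\dots,x_n)=f(\psi;\beta x_1,\dots,\beta x_n)$, and put $$(\delta^nf)(\psi;x_1,\dots,x_{n+1})=\alpha^{n-1}(x_1)\circ_0^\psi f(d_0\psi;x_2,\dots,x_{n+1})$$ $$+\sum_{i=1}^n(-1)^if(d_i\psi;\alpha x_1,\dots,\alpha x_{i-1},x_i\circ_i^\psi x_{i+1},\beta x_{i+2},\dots,\beta x_{n+1})+(-1)^{n+1}f(d_{n+1}\psi;x_1,\dots,x_n)\circ_{n+1}^\psi\beta^{n-1}(x_{n+1}).$$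 This is defined for $n\ge1$, and also for $n=0$ if $\alpha$ and $\beta$ are invertible. **Theorem.** (1) $\delta^n$ maps $C^n(T,V)$ to $C^{n+1}(T,V)$, and $\delta^{n+1}\circ\delta^n=0$, for all $n\ge1$, and also for $n=0$ if $\alpha$ and $\beta$ are invertible. So $(C^*(T,V),\delta^*)$ is a cochain complex (in degrees $\ge0$ if $\alpha,\beta$ are invertible, in degrees $\ge1$ otherwise); its cohomology is denoted $H^n(T,V)$. (2) Let $T$ be an associative trialgebra and $V$ a $T$-module, with identity structure maps. Then, for all $n\ge0$, $C^n(T,V)=\operatorname{Hom}_{\mathbb F}(\mathbb F[\mathcal T_n]\otimes T^{\otimes n},V)$, and $\delta^n$ is the coboundary $$x_1\circ_0^\psi f(d_0\psi;x_2,\dots)+\sum_{i=1}^n(-1)^if(d_i\psi;x_1,\dots,x_i\circ_i^\psi x_{i+1},\dots,x_{n+1})+(-1)^{n+1}f(d_{n+1}\psi;x_1,\dots,x_n)\circ_{n+1}^\psi x_{n+1}$$ of the cohomology $H^n_{\mathrm{Trias}}(T,V)$ of associative trialgebras; hence the identity on cochains induces isomorphisms $H^n(T,V)\cong H^n_{\mathrm{Trias}}(T,V)$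 for all $n\ge0$. (3) Let $(T,\cdot,\alpha,\beta)$ be a multiplicative BiHom-associative algebra and $V$ a bimodule, regarded as a BiHom-associative trialgebra and a BiHom-module with $\dashv=\vdash=\perp$. Let $C^n_{\mathrm{BHA}}(T,V)$, $n\ge1$, be the space of linear maps $f:T^{\otimes n}\to V$ with $\alpha_Vf=f\alpha^{\otimes n}$, $\beta_Vf=f\beta^{\otimes n}$. Its coboundary $\delta^n_{\mathrm{BHA}}f$ is the restriction to $T$ of $\delta^n\tilde f$, where $\tilde f((v_1,x_1),\dots,(v_n,x_n))=(f(x_1,\dots,x_n),0)$ on the semidirect product $A=V\rtimes T$ and, for an algebra $A$ with coefficients in itself, $$(\delta^n g)(a_1,\dots,a_{n+1})=\alpha^{n-1}(a_1)g(a_2,\dots)+\sum_{i=1}^n(-1)^ig(\alpha a_1,\dots,\alpha a_{i-1},a_ia_{i+1},\beta a_{i+2},\dots)+(-1)^{n+1}g(a_1,\dots,a_n)\beta^{n-1}(a_{n+1}).$$ Let $H^n_{\mathrm{BHA}}(T,V)$ be the cohomology of $(C^*_{\mathrm{BHA}},\delta_{\mathrm{BHA}})$. Then $f\mapsto\big((\psi;x_1,\dots,x_n)\mapsto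 f(x_1,\dots,x_n)\big)$ is an injective linear map $C^n_{\mathrm{BHA}}(T,V)\to C^n(T,V)$ whose image consists of the cochains that do not depend on $\psi$; it commutes with the coboundaries ($n\ge1$), and the induced map $H^n_{\mathrm{BHA}}(T,V)\to H^n(T,V)$ is injective for $n\ge2$. -/

import Mathlib

set_option maxSynthPendingDepth 3

/-! ### Planar rooted trees -/

mutual
/-- Planar rooted trees all of whose internal vertices have at least two children.
`node t f` is the grafting of `t` (the leftmost subtree) and the trees of the nonempty list `f`. -/
inductive PTree : Type
  | leaf : PTree
  | node : PTree → PForest → PTree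
/-- Nonempty finite lists of planar rooted trees. -/
inductive PForest : Type
  | single : PTree → PForest
  | cons : PTree → PForest → PForest
end

mutual
/-- Number of leaves of a tree. -/
def PTree.leaves : PTree → ℕ
  | .leaf => 1
  | .node t f => t.leaves + f.leaves
/-- Total number of leaves of a list of trees. -/
def PForest.leaves : PForest → ℕ
  | .single t => t.leaves
  | .cons t f => t.leaves + f.leaves
end

/-- The degree of a tree: its number of leaves minus one. -/
def PTree.degree (t : PTree) : ℕ := t.leaves - 1

/-- Number of trees in a nonempty list. -/
def PForest.length : PForest → ℕ
  | .single _ => 1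
  | .cons _ f => f.length + 1

/-- Last (rightmost) tree of a nonempty list. -/
def PForest.last : PForest → PTree
  | .single t => t
  | .cons _ f => f.last

/-- Join the trees of a nonempty list in a common vertex; a single tree is left as it is
(a vertex with only one child is contracted). -/
def PForest.join : PForest → PTree
  | .single t => t
  | .cons t f => .node t f

mutual
/-- Delete the `i`-th leaf (leaves are numbered `0, 1, 2, …` from left to right). A vertex that
is left with one child is contracted. `none` means that nothing remains. -/
def PTree.delete? : PTree → ℕ → Option PTree
  | .leaf, _ => none
  | .node t f, i =>
    if i < t.leaves then
      match t.delete? i with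
      | none => some f.join
      | some t' => some (.node t' f)
    else
      match f.delete? (i - t.leaves) with
      | none => some t
      | some f' => some (.node t f')
/-- Delete the `i`-th leaf from a list of trees, a tree of which nothing remains being removed from
the list. `none` means that nothing remains. -/
def PForest.delete? : PForest → ℕ → Option PForest
  | .single t, i =>
    match t.delete? i with
    | none => none
    | some t' => some (.single t')
  | .cons t f, i =>
    if i < t.leaves then
      match t.delete? i with
      | none => some f
      | some t' => some (.cons t' f)
    else
      match f.delete? (i - t.leaves) with
      | none => some (.single t)
      | some f' => some (.cons t f')
end

/-- The three operation symbols `⊣`, `⊢`, `⊥`. -/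
inductive TriOp : Type
  | dashv
  | vdash
  | perp

mutual
/-- The orientation of the `i`-th leaf: `⊣` if the leaf is left-oriented (the leftmost child of the
vertex underneath it), `⊢` if it is right-oriented (the rightmost child), `⊥` if it is a middle
leaf. The value at the trivial tree is irrelevant. -/
def PTree.orient : PTree → ℕ → TriOp
  | .leaf, _ => .dashv
  | .node t f, i =>
    if i < t.leaves then
      match t with
      | .leaf => .dashv
      | .node s g => (PTree.node s g).orient i
    else f.orient (i - t.leaves)
/-- The same for the leaves of the non-leftmost children of a vertex. -/
def PForest.orient : PForest → ℕ → TriOp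
  | .single .leaf, _ => .vdash
  | .single (.node s g), i => (PTree.node s g).orient i
  | .cons t f, i =>
    if i < t.leaves then
      match t with
      | .leaf => .perp
      | .node s g => (PTree.node s g).orient i
    else f.orient (i - t.leaves)
end

/-- The operation `∘₀` of `ψ = ψ₀ ∨ ⋯ ∨ ψ_k`. -/
def PTree.opFirst : PTree → TriOp
  | .leaf => .dashv
  | .node t f =>
    if 0 < t.degree then .vdash else if f.length = 1 then .dashv else .perp

/-- The operation `∘_{n+1}` of `ψ = ψ₀ ∨ ⋯ ∨ ψ_k` of degree `n + 1`. -/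
def PTree.opLast : PTree → TriOp
  | .leaf => .dashv
  | .node _ f =>
    if 0 < f.last.degree then .dashv else if f.length = 1 then .vdash else .perp

mutual
theorem PTree.leaves_pos : ∀ t : PTree, 0 < t.leaves
  | .leaf => by simp [PTree.leaves]
  | .node t f => by
    have := PTree.leaves_pos t
    simp only [PTree.leaves]; omega
theorem PForest.leaves_pos : ∀ f : PForest, 0 < f.leaves
  | .single t => by simpa [PForest.leaves] using PTree.leaves_pos t
  | .cons t f => by
    have := PTree.leaves_pos t
    simp only [PForest.leaves]; omega
end

theorem PForest.leaves_join (f : PForest) : f.join.leaves = f.leaves := by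
  cases f <;> simp [PForest.join, PForest.leaves, PTree.leaves]

mutual
theorem PTree.leaves_delete? : ∀ (t : PTree) (i : ℕ), i < t.leaves →
    (t.delete? i).elim 0 PTree.leaves + 1 = t.leaves
  | .leaf, i, _ => by simp [PTree.delete?, PTree.leaves]
  | .node t f, i, h => by
    simp only [PTree.leaves] at h
    simp only [PTree.delete?]
    split_ifs with hi
    · have ih := PTree.leaves_delete? t i hi
      rcases hd : t.delete? i with _ | t' <;> rw [hd] at ih <;>
        simp only [Option.elim, PForest.leaves_join, PTree.leaves] at ih ⊢ <;> omega
    · have ih := PForest.leaves_delete? f (i - t.leaves) (by omega)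
      rcases hd : f.delete? (i - t.leaves) with _ | f' <;> rw [hd] at ih <;>
        simp only [Option.elim, PTree.leaves] at ih ⊢ <;> omega
theorem PForest.leaves_delete? : ∀ (f : PForest) (i : ℕ), i < f.leaves →
    (f.delete? i).elim 0 PForest.leaves + 1 = f.leaves
  | .single t, i, h => by
    simp only [PForest.leaves] at h
    simp only [PForest.delete?]
    have ih := PTree.leaves_delete? t i h
    rcases hd : t.delete? i with _ | t' <;> rw [hd] at ih <;>
      simp only [Option.elim, PForest.leaves] at ih ⊢ <;> omega
  | .cons t f, i, h => by
    simp only [PForest.leaves] at h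
    simp only [PForest.delete?]
    split_ifs with hi
    · have ih := PTree.leaves_delete? t i hi
      rcases hd : t.delete? i with _ | t' <;> rw [hd] at ih <;>
        simp only [Option.elim, PForest.leaves] at ih ⊢ <;> omega
    · have ih := PForest.leaves_delete? f (i - t.leaves) (by omega)
      rcases hd : f.delete? (i - t.leaves) with _ | f' <;> rw [hd] at ih <;>
        simp only [Option.elim, PForest.leaves] at ih ⊢ <;> omega
end

/-- The set `𝒯_n` of trees of degree `n`, that is, with `n + 1` leaves. -/
def TreeDeg (n : ℕ) : Type := {t : PTree // t.leaves = n + 1}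

/-- The map `d_i : 𝒯_{n+1} → 𝒯_n` deleting the `i`-th leaf, `0 ≤ i ≤ n + 1`. -/
def TreeDeg.d {n : ℕ} (i : Fin (n + 2)) (ψ : TreeDeg (n + 1)) : TreeDeg n :=
  ⟨(ψ.1.delete? i).getD .leaf, by
    have hψ := ψ.2
    have hi := i.2
    have h := PTree.leaves_delete? ψ.1 i (by omega)
    rcases hd : ψ.1.delete? i with _ | t <;> rw [hd] at h <;>
      simp only [Option.elim, Option.getD] at h ⊢ <;> omega⟩

/-- The operation assignment `∘_i : 𝒯_{n+1} → {⊣, ⊢, ⊥}`, `0 ≤ i ≤ n + 1`. -/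
def TreeDeg.op {n : ℕ} (i : Fin (n + 2)) (ψ : TreeDeg (n + 1)) : TriOp :=
  if i = 0 then ψ.1.opFirst else if i = Fin.last (n + 1) then ψ.1.opLast else ψ.1.orient i

/-! ### Algebras and modules -/

/-- The eleven triassociativity relations: `TriRel a b c d` stands for
`(x a y) b z = x c (y d z)` (up to the structure maps). -/
inductive TriRel : TriOp → TriOp → TriOp → TriOp → Prop
  | r1 : TriRel .dashv .dashv .dashv .dashv
  | r2 : TriRel .dashv .dashv .dashv .vdash
  | r3 : TriRel .vdash .dashv .vdash .dashv
  | r4 : TriRel .dashv .vdash .vdash .vdash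
  | r5 : TriRel .vdash .vdash .vdash .vdash
  | r6 : TriRel .dashv .dashv .dashv .perp
  | r7 : TriRel .perp .dashv .perp .dashv
  | r8 : TriRel .dashv .perp .perp .vdash
  | r9 : TriRel .vdash .perp .vdash .perp
  | r10 : TriRel .perp .vdash .vdash .vdash
  | r11 : TriRel .perp .perp .perp .perp

section Structures

variable (F : Type*) [Field F] (T : Type*) [AddCommGroup T] [Module F T]

/-- BiHom-associative trialgebras over `F` with underlying vector space `T`. -/
structure BiHomTrialgebra where
  op : TriOp → T →ₗ[F] T →ₗ[F] T
  α : Module.End F T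
  β : Module.End F T
  comm : ∀ x, α (β x) = β (α x)
  assoc : ∀ {a b c d : TriOp}, TriRel a b c d → ∀ x y z,
    op b (op a x y) (β z) = op c (α x) (op d y z)

/-- Multiplicative BiHom-associative trialgebras: the structure maps are homomorphisms. -/
structure MultBiHomTrialgebra extends BiHomTrialgebra F T where
  α_op : ∀ a x y, α (op a x y) = op a (α x) (α y)
  β_op : ∀ a x y, β (op a x y) = op a (β x) (β y)

/-- Associative trialgebras. -/
structure AssocTrialgebra where
  op : TriOp → T →ₗ[F] T →ₗ[F] T
  assoc : ∀ {a b c d : TriOp}, TriRel a b c d → ∀ x y z,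
    op b (op a x y) z = op c x (op d y z)

/-- Multiplicative BiHom-associative algebras. -/
structure BiHomAlgebra where
  mul : T →ₗ[F] T →ₗ[F] T
  α : Module.End F T
  β : Module.End F T
  comm : ∀ x, α (β x) = β (α x)
  assoc : ∀ x y z, mul (mul x y) (β z) = mul (α x) (mul y z)
  α_mul : ∀ x y, α (mul x y) = mul (α x) (α y)
  β_mul : ∀ x y, β (mul x y) = mul (β x) (β y)

variable {F T}
variable (V : Type*) [AddCommGroup V] [Module F V]

/-- BiHom-modules of a BiHom-associative trialgebra. Each of the eleven relations gives three
axioms, one for each position of the module element. -/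
structure BiHomTrialgebra.Mod (S : BiHomTrialgebra F T) where
  α : Module.End F V
  β : Module.End F V
  comm : ∀ v, α (β v) = β (α v)
  left : TriOp → T →ₗ[F] V →ₗ[F] V
  right : TriOp → V →ₗ[F] T →ₗ[F] V
  assoc_left : ∀ {a b c d : TriOp}, TriRel a b c d → ∀ x y v,
    left b (S.op a x y) (β v) = left c (S.α x) (left d y v)
  assoc_mid : ∀ {a b c d : TriOp}, TriRel a b c d → ∀ x v y,
    right b (left a x v) (S.β y) = left c (S.α x) (right d v y)
  assoc_right : ∀ {a b c d : TriOp}, TriRel a b c d → ∀ v x y,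
    right b (right a v x) (S.β y) = right c (α v) (S.op d x y)
  α_left : ∀ a x v, α (left a x v) = left a (S.α x) (α v)
  β_left : ∀ a x v, β (left a x v) = left a (S.β x) (β v)
  α_right : ∀ a v x, α (right a v x) = right a (α v) (S.α x)
  β_right : ∀ a v x, β (right a v x) = right a (β v) (S.β x)

/-- Modules of an associative trialgebra. -/
structure AssocTrialgebra.Mod (S : AssocTrialgebra F T) where
  left : TriOp → T →ₗ[F] V →ₗ[F] V
  right : TriOp → V →ₗ[F] T →ₗ[F] V
  assoc_left : ∀ {a b c d : TriOp}, TriRel a b c d → ∀ x y v,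
    left b (S.op a x y) v = left c x (left d y v)
  assoc_mid : ∀ {a b c d : TriOp}, TriRel a b c d → ∀ x v y,
    right b (left a x v) y = left c x (right d v y)
  assoc_right : ∀ {a b c d : TriOp}, TriRel a b c d → ∀ v x y,
    right b (right a v x) y = right c v (S.op d x y)

/-- Bimodules of a multiplicative BiHom-associative algebra. -/
structure BiHomAlgebra.Bimod (A : BiHomAlgebra F T) where
  α : Module.End F V
  β : Module.End F V
  comm : ∀ v, α (β v) = β (α v)
  left : T →ₗ[F] V →ₗ[F] V
  right : V →ₗ[F] T →ₗ[F] V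
  assoc_left : ∀ x y v, left (A.mul x y) (β v) = left (A.α x) (left y v)
  assoc_mid : ∀ x v y, right (left x v) (A.β y) = left (A.α x) (right v y)
  assoc_right : ∀ v x y, right (right v x) (A.β y) = right (α v) (A.mul x y)
  α_left : ∀ x v, α (left x v) = left (A.α x) (α v)
  β_left : ∀ x v, β (left x v) = left (A.β x) (β v)
  α_right : ∀ v x, α (right v x) = right (α v) (A.α x)
  β_right : ∀ v x, β (right v x) = right (β v) (A.β x)

variable {V}

/-- An associative trialgebra is a BiHom-associative trialgebra with `α = β = id`. -/
def AssocTrialgebra.toBiHom (S : AssocTrialgebra F T) : MultBiHomTrialgebra F T where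
  op := S.op
  α := 1
  β := 1
  comm _ := rfl
  assoc h x y z := S.assoc h x y z
  α_op _ _ _ := rfl
  β_op _ _ _ := rfl

/-- A module of an associative trialgebra, with identity structure maps. -/
def AssocTrialgebra.Mod.toBiHom {S : AssocTrialgebra F T} (M : S.Mod V) :
    S.toBiHom.toBiHomTrialgebra.Mod V where
  α := 1
  β := 1
  comm _ := rfl
  left := M.left
  right := M.right
  assoc_left h x y v := M.assoc_left h x y v
  assoc_mid h x v y := M.assoc_mid h x v y
  assoc_right h v x y := M.assoc_right h v x y
  α_left _ _ _ := rfl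
  β_left _ _ _ := rfl
  α_right _ _ _ := rfl
  β_right _ _ _ := rfl

/-- A BiHom-associative algebra is a BiHom-associative trialgebra with `⊣ = ⊢ = ⊥`. -/
def BiHomAlgebra.toTrialgebra (A : BiHomAlgebra F T) : MultBiHomTrialgebra F T where
  op _ := A.mul
  α := A.α
  β := A.β
  comm := A.comm
  assoc _ := A.assoc
  α_op _ := A.α_mul
  β_op _ := A.β_mul

/-- A bimodule of a BiHom-associative algebra is a BiHom-module of the associated trialgebra. -/
def BiHomAlgebra.Bimod.toTrialgebra {A : BiHomAlgebra F T} (M : A.Bimod V) :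
    A.toTrialgebra.toBiHomTrialgebra.Mod V where
  α := M.α
  β := M.β
  comm := M.comm
  left _ := M.left
  right _ := M.right
  assoc_left _ := M.assoc_left
  assoc_mid _ := M.assoc_mid
  assoc_right _ := M.assoc_right
  α_left _ := M.α_left
  β_left _ := M.β_left
  α_right _ := M.α_right
  β_right _ := M.β_right

/-- The semidirect product `V ⋊ T`. -/
def BiHomAlgebra.Bimod.semidirect {A : BiHomAlgebra F T} (M : A.Bimod V) :
    BiHomAlgebra F (V × T) where
  mul := LinearMap.mk₂ F
    (fun p q => (M.left p.2 q.1 + M.right p.1 q.2, A.mul p.2 q.2))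
    (by intro p p' q; ext <;> simp; abel)
    (by intro c p q; ext <;> simp)
    (by intro p q q'; ext <;> simp; abel)
    (by intro c p q; ext <;> simp)
  α := M.α.prodMap A.α
  β := M.β.prodMap A.β
  comm p := by ext <;> simp [M.comm, A.comm]
  assoc p q r := by
    ext
    · simp [M.assoc_left, M.assoc_mid, M.assoc_right, add_assoc]
    · simp [A.assoc]
  α_mul p q := by ext <;> simp [M.α_left, M.α_right, A.α_mul]
  β_mul p q := by ext <;> simp [M.β_left, M.β_right, A.β_mul]

end Structures

/-! ### The three kinds of terms of a coboundary -/

section Terms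

variable {F : Type*} [Field F] {T : Type*} [AddCommGroup T] [Module F T]
  {V : Type*} [AddCommGroup V] [Module F V] {n : ℕ}

/-- `(x₁, …, x_{n+1}) ↦ L(x₁, f(x₂, …, x_{n+1}))`. -/
def leftTerm (L : T →ₗ[F] V →ₗ[F] V) (f : MultilinearMap F (fun _ : Fin n => T) V) :
    MultilinearMap F (fun _ : Fin (n + 1) => T) V :=
  LinearMap.uncurryLeft (M := fun _ : Fin (n + 1) => T)
    { toFun := fun x => (L x).compMultilinearMap f
      map_add' := fun x y => by ext; simp
      map_smul' := fun c x => by ext; simp }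

/-- `(x₁, …, x_{n+1}) ↦ R(f(x₁, …, x_n), x_{n+1})`. -/
def rightTerm (R : V →ₗ[F] T →ₗ[F] V) (f : MultilinearMap F (fun _ : Fin n => T) V) :
    MultilinearMap F (fun _ : Fin (n + 1) => T) V :=
  MultilinearMap.uncurryRight (M := fun _ : Fin (n + 1) => T) (R.compMultilinearMap f)

/-- `(α x₁, …, α x_{i-1}, m(x_i, x_{i+1}), β x_{i+2}, …, β x_{n+1})` for `1 ≤ i ≤ n`;
in the code all indices start at `0`. -/
def mergeArgs (m : T →ₗ[F] T →ₗ[F] T) (α β : Module.End F T) (i : Fin n)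
    (x : Fin (n + 1) → T) : Fin n → T := fun j =>
  if j < i then α (x j.castSucc)
  else if j = i then m (x i.castSucc) (x i.succ)
  else β (x j.succ)

theorem mergeArgs_update (m : T →ₗ[F] T →ₗ[F] T) (α β : Module.End F T) (i : Fin n)
    [DecidableEq (Fin (n + 1))] (x : Fin (n + 1) → T) (k : Fin (n + 1)) :
    ∃ (j : Fin n) (L : T →ₗ[F] T), ∀ c : T,
      mergeArgs m α β i (Function.update x k c) =
        Function.update (mergeArgs m α β i x) j (L c) := by
  have hne : ∀ (a b : Fin (n + 1)) (c : T), a.val ≠ b.val → Function.update x b c a = x a :=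
    fun a b c h => Function.update_of_ne (fun e => h (congrArg Fin.val e)) _ _
  have heq : ∀ (a b : Fin (n + 1)) (c : T), a.val = b.val → Function.update x b c a = c :=
    fun a b c h => by rw [Fin.ext h]; exact Function.update_self _ _ _
  have hi := i.2
  have hk := k.2
  rcases lt_trichotomy k.val i.val with h | h | h
  · refine ⟨⟨k.val, by omega⟩, α, fun c => funext fun j => ?_⟩
    by_cases hj : j = ⟨k.val, by omega⟩
    · subst hj
      rw [Function.update_self]
      simp only [mergeArgs]
      rw [if_pos (show (⟨k.val, _⟩ : Fin n) < i from h), heq _ _ _ (by simp)]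
    · rw [Function.update_of_ne hj]
      have hj' : j.val ≠ k.val := fun e => hj (Fin.ext e)
      simp only [mergeArgs]
      split_ifs with h1 h2
      · rw [hne _ _ _ (by simpa using hj')]
      · rw [hne _ _ _ (by simp; omega), hne _ _ _ (by simp; omega)]
      · have : ¬ j.val < i.val := h1
        rw [hne _ _ _ (by simp; omega)]
  · refine ⟨i, m.flip (x i.succ), fun c => funext fun j => ?_⟩
    by_cases hj : j = i
    · subst hj
      rw [Function.update_self]
      simp only [mergeArgs, lt_irrefl, if_false, if_true]
      rw [heq _ _ _ (by simpa using h.symm), hne _ _ _ (by simp; omega)]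
      rfl
    · rw [Function.update_of_ne hj]
      have hj' : j.val ≠ i.val := fun e => hj (Fin.ext e)
      simp only [mergeArgs, if_neg hj]
      split_ifs with h1
      · rw [hne _ _ _ (by simp; omega)]
      · have : ¬ j.val < i.val := h1
        rw [hne _ _ _ (by simp; omega)]
  · by_cases h' : k.val = i.val + 1
    · refine ⟨i, m (x i.castSucc), fun c => funext fun j => ?_⟩
      by_cases hj : j = i
      · subst hj
        rw [Function.update_self]
        simp only [mergeArgs, lt_irrefl, if_false, if_true]
        rw [hne _ _ _ (by simp; omega), heq _ _ _ (by simp; omega)]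
      · rw [Function.update_of_ne hj]
        have hj' : j.val ≠ i.val := fun e => hj (Fin.ext e)
        simp only [mergeArgs, if_neg hj]
        split_ifs with h1
        · have : j.val < i.val := h1
          rw [hne _ _ _ (by simp; omega)]
        · rw [hne _ _ _ (by simp; omega)]
    · refine ⟨⟨k.val - 1, by omega⟩, β, fun c => funext fun j => ?_⟩
      by_cases hj : j = ⟨k.val - 1, by omega⟩
      · subst hj
        rw [Function.update_self]
        simp only [mergeArgs]
        rw [if_neg (by rw [Fin.lt_def]; simp; omega), if_neg (by rw [Fin.ext_iff]; simp; omega),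
          heq _ _ _ (by simp; omega)]
      · rw [Function.update_of_ne hj]
        have hj' : j.val ≠ k.val - 1 := fun e => hj (Fin.ext e)
        simp only [mergeArgs]
        split_ifs with h1 h2
        · have : j.val < i.val := h1
          rw [hne _ _ _ (by simp; omega)]
        · rw [hne _ _ _ (by simp; omega), hne _ _ _ (by simp; omega)]
        · rw [hne _ _ _ (by simp; omega)]

/-- `(x₁, …, x_{n+1}) ↦ f(α x₁, …, α x_{i-1}, m(x_i, x_{i+1}), β x_{i+2}, …, β x_{n+1})`. -/
def midTerm (m : T →ₗ[F] T →ₗ[F] T) (α β : Module.End F T) (i : Fin n)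
    (f : MultilinearMap F (fun _ : Fin n => T) V) :
    MultilinearMap F (fun _ : Fin (n + 1) => T) V where
  toFun x := f (mergeArgs m α β i x)
  map_update_add' x k a b := by
    obtain ⟨j, L, h⟩ := mergeArgs_update m α β i x k
    rw [h, h, h, map_add, f.map_update_add]
  map_update_smul' x k c a := by
    obtain ⟨j, L, h⟩ := mergeArgs_update m α β i x k
    rw [h, h, map_smul, f.map_update_smul]

/-- The power `φ^{n-1}`; for `n = 0` this is the inverse of `φ` (only meaningful when `φ` is
invertible). -/
noncomputable def predPow (φ : Module.End F T) : ℕ → Module.End F T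
  | 0 => Ring.inverse φ
  | n + 1 => φ ^ n

theorem leftTerm_apply (L : T →ₗ[F] V →ₗ[F] V) (f : MultilinearMap F (fun _ : Fin n => T) V)
    (x : Fin (n + 1) → T) : leftTerm L f x = L (x 0) (f fun j => x j.succ) := rfl

theorem rightTerm_apply (R : V →ₗ[F] T →ₗ[F] V) (f : MultilinearMap F (fun _ : Fin n => T) V)
    (x : Fin (n + 1) → T) :
    rightTerm R f x = R (f fun j => x j.castSucc) (x (Fin.last n)) := rfl

theorem midTerm_apply (m : T →ₗ[F] T →ₗ[F] T) (α β : Module.End F T) (i : Fin n)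
    (f : MultilinearMap F (fun _ : Fin n => T) V) (x : Fin (n + 1) → T) :
    midTerm m α β i f x = f (mergeArgs m α β i x) := rfl

theorem mergeArgs_comp (m : T →ₗ[F] T →ₗ[F] T) (α β γ : Module.End F T) (i : Fin n)
    (hα : ∀ x, α (γ x) = γ (α x)) (hβ : ∀ x, β (γ x) = γ (β x))
    (hm : ∀ x y, γ (m x y) = m (γ x) (γ y)) (x : Fin (n + 1) → T) :
    mergeArgs m α β i (fun j => γ (x j)) = fun j => γ (mergeArgs m α β i x j) := by
  funext j
  simp only [mergeArgs]
  split_ifs <;> simp [hα, hβ, hm]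

theorem predPow_commute {φ γ : Module.End F T} (h : Commute φ γ) (n : ℕ) (x : T) :
    predPow φ n (γ x) = γ (predPow φ n x) := by
  have key : Commute (predPow φ n) γ := by
    cases n with
    | succ n => exact h.pow_left n
    | zero =>
      simp only [predPow]
      by_cases hu : IsUnit φ
      · obtain ⟨u, rfl⟩ := hu
        rw [Ring.inverse_unit]
        exact h.units_inv_left
      · rw [Ring.inverse_non_unit _ hu]
        exact Commute.zero_left _
  exact LinearMap.congr_fun key.eq x

end Terms

/-! ### The cochain complex of a BiHom-associative trialgebra -/

namespace MultBiHomTrialgebra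

variable {F : Type*} [Field F] {T : Type*} [AddCommGroup T] [Module F T]
  {V : Type*} [AddCommGroup V] [Module F V]
  (S : MultBiHomTrialgebra F T) (M : S.toBiHomTrialgebra.Mod V)

/-- The group of `n`-cochains. A linear map `F[𝒯_n] ⊗ T^{⊗n} → V` is given by a family, indexed
by the basis `𝒯_n`, of multilinear maps `Tⁿ → V`; cochains are those families that commute with
the structure maps. -/
def cochain (n : ℕ) : Submodule F (TreeDeg n → MultilinearMap F (fun _ : Fin n => T) V) where
  carrier := {f | ∀ ψ x, M.α (f ψ x) = f ψ (fun i => S.α (x i)) ∧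
    M.β (f ψ x) = f ψ (fun i => S.β (x i))}
  add_mem' hf hg ψ x := by simp [hf ψ x, hg ψ x]
  zero_mem' ψ x := by simp
  smul_mem' c f hf ψ x := by simp [hf ψ x]

/-- The formula of the coboundary of an arbitrary family of multilinear maps. -/
noncomputable def coboundaryFormula {n : ℕ}
    (f : TreeDeg n → MultilinearMap F (fun _ : Fin n => T) V) (ψ : TreeDeg (n + 1)) :
    MultilinearMap F (fun _ : Fin (n + 1) => T) V :=
  leftTerm (M.left (ψ.op 0) ∘ₗ predPow S.α n) (f (ψ.d 0))
  + ∑ i : Fin n, (-1 : F) ^ (i.val + 1) •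
      midTerm (S.op (ψ.op i.succ.castSucc)) S.α S.β i (f (ψ.d i.succ.castSucc))
  + (-1 : F) ^ (n + 1) •
      rightTerm ((M.right (ψ.op (Fin.last (n + 1)))).compl₂ (predPow S.β n))
        (f (ψ.d (Fin.last (n + 1))))

theorem coboundaryFormula_mem {n : ℕ}
    {f : TreeDeg n → MultilinearMap F (fun _ : Fin n => T) V} (hf : f ∈ S.cochain M n) :
    S.coboundaryFormula M f ∈ S.cochain M (n + 1) := by
  have hc : Commute S.α S.β := LinearMap.ext S.comm
  intro ψ x
  constructor
  · simp only [coboundaryFormula, add_apply, sum_apply,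
      smul_apply, leftTerm_apply, rightTerm_apply, midTerm_apply, map_add, map_sum,
      map_smul, LinearMap.comp_apply, LinearMap.compl₂_apply, M.α_left, M.α_right,
      predPow_commute (Commute.refl S.α), predPow_commute hc.symm, (hf _ _).1]
    congr 2
    refine Finset.sum_congr rfl fun i _ => ?_
    rw [mergeArgs_comp _ _ _ S.α _ (fun _ => rfl) (fun y => (S.comm y).symm) (S.α_op _)]
  · simp only [coboundaryFormula, add_apply, sum_apply,
      smul_apply, leftTerm_apply, rightTerm_apply, midTerm_apply, map_add, map_sum,
      map_smul, LinearMap.comp_apply, LinearMap.compl₂_apply, M.β_left, M.β_right,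
      predPow_commute (Commute.refl S.β), predPow_commute hc, (hf _ _).2]
    congr 2
    refine Finset.sum_congr rfl fun i _ => ?_
    rw [mergeArgs_comp _ _ _ S.β _ S.comm (fun _ => rfl) (S.β_op _)]

/-- The coboundary map `δⁿ : Cⁿ(T, V) → Cⁿ⁺¹(T, V)`. Since its formula involves `α^{n-1}` and
`β^{n-1}`, the map `δ⁰` is only meaningful when `α` and `β` are invertible. -/
noncomputable def δ (n : ℕ) : S.cochain M n →ₗ[F] S.cochain M (n + 1) where
  toFun f := ⟨S.coboundaryFormula M f.1, S.coboundaryFormula_mem M f.2⟩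
  map_add' f g := by
    ext ψ x
    simp only [coboundaryFormula, Submodule.coe_add, Pi.add_apply, add_apply,
      sum_apply, smul_apply, leftTerm_apply, rightTerm_apply,
      midTerm_apply, map_add, LinearMap.add_apply, smul_add, Finset.sum_add_distrib]
    abel
  map_smul' c f := by
    ext ψ x
    simp only [coboundaryFormula, Submodule.coe_smul, Pi.smul_apply, add_apply,
      sum_apply, smul_apply, leftTerm_apply, rightTerm_apply,
      midTerm_apply, map_smul, LinearMap.smul_apply, RingHom.id_apply, smul_add, Finset.smul_sum]
    simp only [smul_comm c]

/-- Cocycles: the kernel of `δⁿ`. -/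
noncomputable def cocycles (n : ℕ) : Submodule F (S.cochain M n) := LinearMap.ker (S.δ M n)

open Classical in
/-- Coboundaries: the image of the preceding coboundary map. When `α` or `β` is not invertible, there
is no map `δ⁰` and the complex starts in degree `1`. -/
noncomputable def coboundaries : (n : ℕ) → Submodule F (S.cochain M n)
  | 0 => ⊥
  | 1 => if IsUnit S.α ∧ IsUnit S.β then LinearMap.range (S.δ M 0) else ⊥
  | n + 2 => LinearMap.range (S.δ M (n + 1))

/-- The Hochschild cohomology `Hⁿ(T, V)`: cocycles modulo coboundaries (for `n = 0` it is
only meaningful when `α` and `β` are invertible). -/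
abbrev H (n : ℕ) : Type _ :=
  S.cocycles M n ⧸ (S.coboundaries M n).submoduleOf (S.cocycles M n)

end MultBiHomTrialgebra

/-! ### The cochain complex of an associative trialgebra -/

namespace AssocTrialgebra

variable {F : Type*} [Field F] {T : Type*} [AddCommGroup T] [Module F T]
  {V : Type*} [AddCommGroup V] [Module F V]
  (S : AssocTrialgebra F T) (M : S.Mod V)

/-- The coboundary map on `Cⁿ(T, V) = Hom(F[𝒯_n] ⊗ T^{⊗n}, V)`. -/
def δ (n : ℕ) : (TreeDeg n → MultilinearMap F (fun _ : Fin n => T) V) →ₗ[F]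
    (TreeDeg (n + 1) → MultilinearMap F (fun _ : Fin (n + 1) => T) V) where
  toFun f ψ :=
    leftTerm (M.left (ψ.op 0)) (f (ψ.d 0))
    + ∑ i : Fin n, (-1 : F) ^ (i.val + 1) •
        midTerm (S.op (ψ.op i.succ.castSucc)) 1 1 i (f (ψ.d i.succ.castSucc))
    + (-1 : F) ^ (n + 1) •
        rightTerm (M.right (ψ.op (Fin.last (n + 1)))) (f (ψ.d (Fin.last (n + 1))))
  map_add' f g := by
    ext ψ x
    simp only [Pi.add_apply, add_apply,
      sum_apply, smul_apply, leftTerm_apply, rightTerm_apply,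
      midTerm_apply, map_add, LinearMap.add_apply, smul_add, Finset.sum_add_distrib]
    abel
  map_smul' c f := by
    ext ψ x
    simp only [Pi.smul_apply, add_apply,
      sum_apply, smul_apply, leftTerm_apply, rightTerm_apply,
      midTerm_apply, map_smul, LinearMap.smul_apply, RingHom.id_apply, smul_add, Finset.smul_sum]
    simp only [smul_comm c]

/-- Cocycles. -/
def cocycles (n : ℕ) :
    Submodule F (TreeDeg n → MultilinearMap F (fun _ : Fin n => T) V) := LinearMap.ker (S.δ M n)

/-- Coboundaries. -/
def coboundaries : (n : ℕ) →
    Submodule F (TreeDeg n → MultilinearMap F (fun _ : Fin n => T) V)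
  | 0 => ⊥
  | n + 1 => LinearMap.range (S.δ M n)

/-- The cohomology of an associative trialgebra with coefficients in a module. -/
abbrev H (n : ℕ) : Type _ :=
  S.cocycles M n ⧸ (S.coboundaries M n).submoduleOf (S.cocycles M n)

end AssocTrialgebra

/-! ### The cochain complex of a BiHom-associative algebra -/

namespace BiHomAlgebra

variable {F : Type*} [Field F] {T : Type*} [AddCommGroup T] [Module F T]
  {V : Type*} [AddCommGroup V] [Module F V]

/-- The coboundary formula for cochains of degree `n + 1` of an algebra with values in itself. -/
def selfCoboundary (A : BiHomAlgebra F T) {n : ℕ}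
    (f : MultilinearMap F (fun _ : Fin (n + 1) => T) T) :
    MultilinearMap F (fun _ : Fin (n + 2) => T) T :=
  leftTerm (A.mul ∘ₗ A.α ^ n) f
  + ∑ i : Fin (n + 1), (-1 : F) ^ (i.val + 1) • midTerm A.mul A.α A.β i f
  + (-1 : F) ^ (n + 2) • rightTerm (A.mul.compl₂ (A.β ^ n)) f

variable (A : BiHomAlgebra F T) (M : A.Bimod V)

/-- The space of `n`-cochains with values in a bimodule. -/
def cochain (n : ℕ) : Submodule F (MultilinearMap F (fun _ : Fin n => T) V) where
  carrier := {f | ∀ x, M.α (f x) = f (fun i => A.α (x i)) ∧ M.β (f x) = f (fun i => A.β (x i))}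
  add_mem' hf hg x := by simp [hf x, hg x]
  zero_mem' x := by simp
  smul_mem' c f hf x := by simp [hf x]

/-- The extension `((v₁, x₁), …, (v_n, x_n)) ↦ (f(x₁, …, x_n), 0)` of `f` to `V ⋊ T`. -/
def extend {n : ℕ} (f : MultilinearMap F (fun _ : Fin n => T) V) :
    MultilinearMap F (fun _ : Fin n => V × T) (V × T) :=
  (LinearMap.inl F V T).compMultilinearMap (f.compLinearMap fun _ => LinearMap.snd F V T)

/-- Extend `f` to `V ⋊ T`, take the coboundary there, and restrict it to `T`. -/
def coboundaryFormula {n : ℕ} (f : MultilinearMap F (fun _ : Fin (n + 1) => T) V) :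
    MultilinearMap F (fun _ : Fin (n + 2) => T) V :=
  (LinearMap.fst F V T).compMultilinearMap
    ((M.semidirect.selfCoboundary (extend f)).compLinearMap fun _ => LinearMap.inr F V T)

theorem mergeArgs_inr {n : ℕ} (i : Fin n) (x : Fin (n + 1) → T) (j : Fin n) :
    (mergeArgs M.semidirect.mul M.semidirect.α M.semidirect.β i
      (fun k => ((0 : V), x k)) j).2 = mergeArgs A.mul A.α A.β i x j := by
  simp only [mergeArgs]
  split_ifs <;> simp [Bimod.semidirect]

theorem semidirect_α_pow (n : ℕ) (p : V × T) :
    (M.semidirect.α ^ n) p = ((M.α ^ n) p.1, (A.α ^ n) p.2) := by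
  induction n generalizing p with
  | zero => rfl
  | succ n ih => rw [pow_succ, Module.End.mul_apply, ih]; rfl

theorem semidirect_β_pow (n : ℕ) (p : V × T) :
    (M.semidirect.β ^ n) p = ((M.β ^ n) p.1, (A.β ^ n) p.2) := by
  induction n generalizing p with
  | zero => rfl
  | succ n ih => rw [pow_succ, Module.End.mul_apply, ih]; rfl

/-- The coboundary with coefficients in a bimodule, written out. -/
theorem coboundaryFormula_apply {n : ℕ} (f : MultilinearMap F (fun _ : Fin (n + 1) => T) V)
    (x : Fin (n + 2) → T) :
    coboundaryFormula A M f x = M.left ((A.α ^ n) (x 0)) (f fun j => x j.succ)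
      + ∑ i : Fin (n + 1), (-1 : F) ^ (i.val + 1) • f (mergeArgs A.mul A.α A.β i x)
      + (-1 : F) ^ (n + 2) •
        M.right (f fun j => x j.castSucc) ((A.β ^ n) (x (Fin.last (n + 1)))) := by
  simp [coboundaryFormula, selfCoboundary, leftTerm_apply, midTerm_apply, rightTerm_apply,
    extend, mergeArgs_inr, Prod.fst_sum, semidirect_α_pow, semidirect_β_pow]
  simp [Bimod.semidirect]

theorem coboundaryFormula_mem {n : ℕ} {f : MultilinearMap F (fun _ : Fin (n + 1) => T) V}
    (hf : f ∈ cochain A M (n + 1)) : coboundaryFormula A M f ∈ cochain A M (n + 2) := by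
  have hc : Commute A.α A.β := LinearMap.ext A.comm
  intro x
  have p1 : ∀ y, (A.α ^ n) (A.α y) = A.α ((A.α ^ n) y) := predPow_commute (Commute.refl _) (n + 1)
  have p2 : ∀ y, (A.α ^ n) (A.β y) = A.β ((A.α ^ n) y) := predPow_commute hc (n + 1)
  have p3 : ∀ y, (A.β ^ n) (A.α y) = A.α ((A.β ^ n) y) := predPow_commute hc.symm (n + 1)
  have p4 : ∀ y, (A.β ^ n) (A.β y) = A.β ((A.β ^ n) y) := predPow_commute (Commute.refl _) (n + 1)
  constructor
  · simp only [coboundaryFormula_apply, map_add, map_sum, map_smul, M.α_left, M.α_right, p1, p3,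
      (hf _).1, mergeArgs_comp _ _ _ A.α _ (fun _ => rfl) (fun y => (A.comm y).symm) A.α_mul]
  · simp only [coboundaryFormula_apply, map_add, map_sum, map_smul, M.β_left, M.β_right, p2, p4,
      (hf _).2, mergeArgs_comp _ _ _ A.β _ A.comm (fun _ => rfl) A.β_mul]

/-- The coboundary map with coefficients in a bimodule, from degree `n + 1` to degree `n + 2`. -/
def δ (n : ℕ) : cochain A M (n + 1) →ₗ[F] cochain A M (n + 2) where
  toFun f := ⟨coboundaryFormula A M f.1, coboundaryFormula_mem A M f.2⟩
  map_add' f g := by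
    ext x
    simp only [Submodule.coe_add, add_apply, coboundaryFormula_apply, map_add,
      LinearMap.add_apply, smul_add, Finset.sum_add_distrib]
    abel
  map_smul' c f := by
    ext x
    simp only [Submodule.coe_smul, smul_apply, coboundaryFormula_apply, map_smul,
      LinearMap.smul_apply, RingHom.id_apply, smul_add, Finset.smul_sum]
    simp only [smul_comm c]

/-- Cocycles in degree `n + 1`. -/
def cocycles (n : ℕ) : Submodule F (cochain A M (n + 1)) := LinearMap.ker (δ A M n)

/-- Coboundaries in degree `n + 1`; the complex starts in degree `1`. -/
def coboundaries : (n : ℕ) → Submodule F (cochain A M (n + 1))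
  | 0 => ⊥
  | n + 1 => LinearMap.range (δ A M n)

/-- The cohomology, in degree `n + 1`, of a BiHom-associative algebra with coefficients in a
bimodule. -/
abbrev H (n : ℕ) : Type _ :=
  cocycles A M n ⧸ (coboundaries A M n).submoduleOf (cocycles A M n)

/-- A cochain of a BiHom-associative algebra, regarded as a tree-independent cochain of the
associated BiHom-associative trialgebra. -/
def const (n : ℕ) : cochain A M n →ₗ[F] A.toTrialgebra.cochain M.toTrialgebra n where
  toFun f := ⟨fun _ => f.1, fun _ x => f.2 x⟩
  map_add' _ _ := rfl
  map_smul' _ _ := rfl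

end BiHomAlgebra

/-! ### Deletion of leaves -/

-- The coboundary squares to zero for the usual simplicial reason. It is an alternating sum of
-- faces, the faces satisfy the presimplicial identities (`face_face`), and then the terms cancel in
-- pairs (`sum_alternating_eq_zero`). The tree part of each identity is the commutation of leaf
-- deletions (`PTree.del_comm`). If two faces act independently, it remains to know that the
-- operation symbols survive the deletion and that the structure maps are multiplicative. If they
-- interact, a triassociativity relation is needed whose four symbols come from the tree and from
-- its faces.
--
-- That these four symbols always form one of the eleven relations is the heart of the matter. A
-- case analysis on trees is avoided by recording a tree through its gaps: `w k` is a height of the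
-- vertex at which leaves `k - 1` and `k` separate. Deleting leaf `j` replaces gaps `j` and `j + 1`
-- by their minimum. The symbol at an inner leaf compares the two gaps beside it; the first symbol
-- compares gap 1 with the minimum of all later gaps, and the last one is its mirror image. Every
-- quadruple that occurs is then `cmp a b`, `cmp (min a b) c`, `cmp a (min b c)`, `cmp b c` for
-- three elements of a linear order, and `triRel_cmp` identifies these with the eleven relations.
--
-- For identity structure maps the compatibility conditions and the powers are trivial, so the two
-- complexes agree. If the three operations coincide, the symbols are irrelevant and
-- tree-independent cochains form a subcomplex. Every face of a corolla is a corolla, so evaluation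
-- at corollas is a chain map that retracts onto this subcomplex; this gives injectivity on
-- cohomology.

theorem PForest.delete?_join (f : PForest) (i : ℕ) :
    f.join.delete? i = (f.delete? i).map PForest.join := by
  cases f with
  | single t =>
    simp only [PForest.join, PForest.delete?]
    cases t.delete? i <;> rfl
  | cons t f =>
    simp only [PForest.join, PForest.delete?, PTree.delete?]
    split_ifs
    · cases t.delete? i <;> rfl
    · cases f.delete? (i - t.leaves) <;> rfl

theorem PTree.leaves_of_delete? {t t' : PTree} {i : ℕ} (hi : i < t.leaves)
    (h : t.delete? i = some t') : t'.leaves + 1 = t.leaves := by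
  simpa [h] using PTree.leaves_delete? t i hi

theorem PForest.leaves_of_delete? {f f' : PForest} {i : ℕ} (hi : i < f.leaves)
    (h : f.delete? i = some f') : f'.leaves + 1 = f.leaves := by
  simpa [h] using PForest.leaves_delete? f i hi

theorem PTree.leaves_of_delete?_none {t : PTree} {i : ℕ} (hi : i < t.leaves)
    (h : t.delete? i = none) : t.leaves = 1 := by
  simpa [h] using (PTree.leaves_delete? t i hi).symm

theorem PForest.leaves_of_delete?_none {f : PForest} {i : ℕ} (hi : i < f.leaves)
    (h : f.delete? i = none) : f.leaves = 1 := by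
  simpa [h] using (PForest.leaves_delete? f i hi).symm

/-- The induction step shared by trees and lists, a vertex being the join of a list `cons t f`.
Either both leaves lie in `t`, or both in `f`, or one in each; in the mixed case either part may
vanish. -/
theorem PForest.delete?_cons_comm {t : PTree} {f : PForest}
    (ht : ∀ i j, i ≤ j → j + 1 < t.leaves →
      (t.delete? (j + 1)).bind (PTree.delete? · i) = (t.delete? i).bind (PTree.delete? · j))
    (hf : ∀ i j, i ≤ j → j + 1 < f.leaves →
      (f.delete? (j + 1)).bind (PForest.delete? · i) = (f.delete? i).bind (PForest.delete? · j))
    (i j : ℕ) (hij : i ≤ j) (hj : j + 1 < (PForest.cons t f).leaves) :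
    ((PForest.cons t f).delete? (j + 1)).bind (PForest.delete? · i) =
      ((PForest.cons t f).delete? i).bind (PForest.delete? · j) := by
  simp only [PForest.leaves] at hj
  by_cases h1 : j + 1 < t.leaves
  · have H := ht i j hij h1
    have hi : i < t.leaves := by omega
    simp only [PForest.delete?, h1, hi, if_true]
    rcases e1 : t.delete? (j + 1) with _ | t1
    · have := PTree.leaves_of_delete?_none h1 e1; omega
    rcases e2 : t.delete? i with _ | t2
    · have := PTree.leaves_of_delete?_none hi e2; omega
    have l1 := PTree.leaves_of_delete? h1 e1
    have l2 := PTree.leaves_of_delete? hi e2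
    rw [e1, e2] at H
    simp only [Option.bind_some] at H ⊢
    simp only [PForest.delete?]
    rw [if_pos (by omega), if_pos (by omega), H]
  · by_cases hi : i < t.leaves
    · simp only [PForest.delete?, h1, hi, if_true, if_false]
      -- If nothing remains of `t`, it was a single leaf, and the second deletion happens at index
      -- `j` of `f` in either order.
      rcases e2 : t.delete? i with _ | t2
      · have l2 := PTree.leaves_of_delete?_none hi e2
        simp only [Option.bind_some]
        rw [show j + 1 - t.leaves = j by omega]
        rcases e1 : f.delete? j with _ | f1
        · simp only [Option.bind_some, PForest.delete?, e2]
        · simp only [Option.bind_some, PForest.delete?, e2, hi, if_true]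
      · have l2 := PTree.leaves_of_delete? hi e2
        simp only [Option.bind_some, PForest.delete?]
        rw [if_neg (by omega), show j - t2.leaves = j + 1 - t.leaves by omega]
        rcases e1 : f.delete? (j + 1 - t.leaves) with _ | f1
        · simp only [Option.bind_some, PForest.delete?, e2]
        · simp only [Option.bind_some, PForest.delete?, e2, hi, if_true]
    · have H := hf (i - t.leaves) (j - t.leaves) (by omega) (by omega)
      have h2 : ¬ j < t.leaves := by omega
      simp only [PForest.delete?, h1, hi, if_false]
      rw [show j + 1 - t.leaves = j - t.leaves + 1 by omega]
      rcases e1 : f.delete? (j - t.leaves + 1) with _ | f1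
      · have := PForest.leaves_of_delete?_none (by omega) e1; omega
      rcases e2 : f.delete? (i - t.leaves) with _ | f2
      · have := PForest.leaves_of_delete?_none (by omega) e2; omega
      rw [e1, e2] at H
      simp only [Option.bind_some] at H ⊢
      simp only [PForest.delete?, hi, h2, if_false, H]

mutual
theorem PTree.delete?_comm : ∀ (t : PTree) (i j : ℕ), i ≤ j → j + 1 < t.leaves →
    (t.delete? (j + 1)).bind (PTree.delete? · i) = (t.delete? i).bind (PTree.delete? · j)
  | .leaf, i, j, _, h => by simp [PTree.leaves] at h
  | .node t f, i, j, hij, h => by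
    have H := PForest.delete?_cons_comm (PTree.delete?_comm t) (PForest.delete?_comm f) i j hij h
    -- Joining commutes with deletion, so the claim is the image under `PForest.join` of the one for
    -- lists.
    have e : PTree.node t f = (PForest.cons t f).join := rfl
    rw [e, PForest.delete?_join, PForest.delete?_join]
    have := congrArg (Option.map PForest.join) H
    simpa only [Option.map_bind, Option.bind_map, Function.comp_def, PForest.delete?_join] using this
theorem PForest.delete?_comm : ∀ (f : PForest) (i j : ℕ), i ≤ j → j + 1 < f.leaves →
    (f.delete? (j + 1)).bind (PForest.delete? · i) = (f.delete? i).bind (PForest.delete? · j)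
  | .single t, i, j, hij, h => by
    have H := PTree.delete?_comm t i j hij h
    have e : ∀ (t : PTree) k, (PForest.single t).delete? k = (t.delete? k).map .single := by
      intro t k
      simp only [PForest.delete?]
      cases t.delete? k <;> rfl
    rw [e, e]
    have := congrArg (Option.map PForest.single) H
    simpa only [Option.map_bind, Option.bind_map, Function.comp_def, e] using this
  | .cons t f, i, j, hij, h =>
    PForest.delete?_cons_comm (PTree.delete?_comm t) (PForest.delete?_comm f) i j hij h
end

/-- Deletion of the `i`-th leaf of a tree with at least two leaves. -/
def PTree.del (t : PTree) (i : ℕ) : PTree := (t.delete? i).getD .leaf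

theorem PTree.delete?_eq_some {t : PTree} {i : ℕ} (h : 2 ≤ t.leaves) (hi : i < t.leaves) :
    t.delete? i = some (t.del i) := by
  rcases e : t.delete? i with _ | t'
  · have := PTree.leaves_of_delete?_none hi e
    omega
  · simp [PTree.del, e]

theorem PTree.leaves_del {t : PTree} {i : ℕ} (h : 2 ≤ t.leaves) (hi : i < t.leaves) :
    (t.del i).leaves + 1 = t.leaves :=
  PTree.leaves_of_delete? hi (PTree.delete?_eq_some h hi)

theorem PTree.del_comm {t : PTree} {i j : ℕ} (hij : i ≤ j) (hj : j + 1 < t.leaves) :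
    (t.del (j + 1)).del i = (t.del i).del j := by
  have H := PTree.delete?_comm t i j hij hj
  rw [PTree.delete?_eq_some (by omega) hj, PTree.delete?_eq_some (by omega) (by omega),
    Option.bind_some, Option.bind_some] at H
  change ((t.del (j + 1)).delete? i).getD .leaf = _
  rw [H]
  rfl

/-! ### Gap sequences -/

mutual
/-- `t.HasGaps w`: for every `0 < k < t.leaves` the number `w k` is a height of the vertex at which
the `(k-1)`-st and the `k`-th leaf separate; the heights grow from the root upwards. -/
def PTree.HasGaps : PTree → (ℕ → ℕ∞) → Prop
  | .leaf, _ => True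
  | .node t f, w => ∃ m, t.HasGaps w ∧ (∀ k, 0 < k → k < t.leaves → m < w k) ∧
      f.HasGaps m (fun k => w (k + t.leaves))
/-- The same for the non-leftmost children of a vertex of height `m`. -/
def PForest.HasGaps : PForest → ℕ∞ → (ℕ → ℕ∞) → Prop
  | .single t, m, w => w 0 = m ∧ t.HasGaps w ∧ ∀ k, 0 < k → k < t.leaves → m < w k
  | .cons t f, m, w => w 0 = m ∧ t.HasGaps w ∧ (∀ k, 0 < k → k < t.leaves → m < w k) ∧
      f.HasGaps m (fun k => w (k + t.leaves))
end

mutual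
-- Only gaps strictly inside a tree are constrained, so the entries at its two ends are free to hold
-- the gaps towards its neighbours in a larger tree. In a list, entry 0 is constrained as well: it
-- is the gap to the preceding sibling.
theorem PTree.HasGaps.congr : ∀ {t : PTree} {w w' : ℕ → ℕ∞}, t.HasGaps w →
    (∀ k, 0 < k → k < t.leaves → w' k = w k) → t.HasGaps w'
  | .leaf, w, w', _, _ => trivial
  | .node t f, w, w', h, e => by
    obtain ⟨m, h1, h2, h3⟩ := h
    have := t.leaves_pos
    simp only [PTree.leaves] at e
    exact ⟨m, h1.congr fun k h h' => e k h (by omega),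
      fun k h h' => by rw [e k h (by omega)]; exact h2 k h h',
      h3.congr fun k h => e _ (by omega) (by omega)⟩
theorem PForest.HasGaps.congr : ∀ {f : PForest} {m : ℕ∞} {w w' : ℕ → ℕ∞}, f.HasGaps m w →
    (∀ k, k < f.leaves → w' k = w k) → f.HasGaps m w'
  | .single t, m, w, w', h, e => by
    obtain ⟨h0, h1, h2⟩ := h
    have := t.leaves_pos
    simp only [PForest.leaves] at e
    exact ⟨by rw [e 0 (by omega), h0], h1.congr fun k h h' => e k (by omega),
      fun k h h' => by rw [e k (by omega)]; exact h2 k h h'⟩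
  | .cons t f, m, w, w', h, e => by
    obtain ⟨h0, h1, h2, h3⟩ := h
    have := t.leaves_pos
    simp only [PForest.leaves] at e
    exact ⟨by rw [e 0 (by omega), h0], h1.congr fun k h h' => e k (by omega),
      fun k h h' => by rw [e k (by omega)]; exact h2 k h h',
      h3.congr fun k h => e _ (by omega)⟩
end

theorem PForest.HasGaps.zero {f : PForest} {m : ℕ∞} {w : ℕ → ℕ∞} (h : f.HasGaps m w) :
    w 0 = m := by
  cases f <;> exact h.1

theorem PForest.HasGaps.le : ∀ {f : PForest} {m : ℕ∞} {w : ℕ → ℕ∞}, f.HasGaps m w →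
    ∀ k, k < f.leaves → m ≤ w k
  | .single t, m, w, h, k, hk => by
    obtain ⟨h0, h1, h2⟩ := h
    rcases Nat.eq_zero_or_pos k with rfl | hk'
    · exact h0.ge
    · exact (h2 k hk' hk).le
  | .cons t f, m, w, h, k, hk => by
    obtain ⟨h0, h1, h2, h3⟩ := h
    rcases Nat.eq_zero_or_pos k with rfl | hk'
    · exact h0.ge
    · simp only [PForest.leaves] at hk
      by_cases hkt : k < t.leaves
      · exact (h2 k hk' hkt).le
      · have := h3.le (k - t.leaves) (by omega)
        rwa [Nat.sub_add_cancel (by omega)] at this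

theorem PForest.HasGaps.join {f : PForest} {m : ℕ∞} {w : ℕ → ℕ∞} (h : f.HasGaps m w) :
    f.join.HasGaps w := by
  cases f with
  | single t => exact h.2.1
  | cons t f => exact ⟨m, h.2.1, h.2.2.1, h.2.2.2⟩

mutual
-- The lower bound `m` lets the recursion put a subtree strictly above the vertex that carries it.
-- Heights are taken in `ℕ` so that all gaps are finite in `ℕ∞`, where `⊤` is reserved for empty
-- infima.
theorem PTree.exists_hasGaps : ∀ (t : PTree) (m : ℕ), ∃ w : ℕ → ℕ,
    t.HasGaps (fun k => (w k : ℕ∞)) ∧ ∀ k, m < w k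
  | .leaf, m => ⟨fun _ => m + 1, trivial, fun _ => Nat.lt_succ_self m⟩
  | .node t f, m => by
    obtain ⟨w, hw, h1⟩ := PTree.exists_hasGaps t (m + 1)
    obtain ⟨v, hv, h2⟩ := PForest.exists_hasGaps f (m + 1)
    refine ⟨fun k => if k < t.leaves then w k else v (k - t.leaves), ⟨((m + 1 : ℕ) : ℕ∞), ?_, ?_, ?_⟩,
      fun k => ?_⟩
    · exact hw.congr fun k _ h => by simp only [h, if_true]
    · intro k _ h
      simp only [h, if_true]
      exact_mod_cast h1 k
    · exact hv.congr fun k h => by simp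
    · dsimp only
      split_ifs
      · exact (Nat.lt_succ_self m).trans (h1 k)
      · exact h2 _
theorem PForest.exists_hasGaps : ∀ (f : PForest) (m : ℕ), ∃ w : ℕ → ℕ,
    f.HasGaps m (fun k => (w k : ℕ∞)) ∧ ∀ k, m ≤ w k
  | .single t, m => by
    obtain ⟨w, hw, h1⟩ := PTree.exists_hasGaps t m
    refine ⟨fun k => if k = 0 then m else w k, ⟨by simp, ?_, ?_⟩, fun k => ?_⟩
    · exact hw.congr fun k h _ => by simp only [h.ne', if_false]
    · intro k h _
      simp only [h.ne', if_false]
      exact_mod_cast h1 k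
    · dsimp only
      split_ifs
      · exact le_rfl
      · exact (h1 k).le
  | .cons t f, m => by
    obtain ⟨w, hw, h1⟩ := PTree.exists_hasGaps t m
    obtain ⟨v, hv, h2⟩ := PForest.exists_hasGaps f m
    have := t.leaves_pos
    refine ⟨fun k => if k = 0 then m else if k < t.leaves then w k else v (k - t.leaves),
      ⟨by simp, ?_, ?_, ?_⟩, fun k => ?_⟩
    · exact hw.congr fun k h h' => by simp only [h.ne', h', if_false, if_true]
    · intro k h h'
      simp only [h.ne', h', if_false, if_true]
      exact_mod_cast h1 k
    · refine hv.congr fun k h => ?_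
      simp only
      rw [if_neg (by omega), if_neg (by omega), Nat.add_sub_cancel]
    · dsimp only
      split_ifs
      · exact le_rfl
      · exact (h1 k).le
      · exact h2 _
end

/-- The gap sequence after deletion of the `j`-th leaf: the gaps on both sides of it merge. -/
noncomputable def mergeGaps (j : ℕ) (w : ℕ → ℕ∞) (k : ℕ) : ℕ∞ :=
  if k < j then w k else if k = j then min (w j) (w (j + 1)) else w (k + 1)

theorem mergeGaps_of_lt {j k : ℕ} (w : ℕ → ℕ∞) (h : k < j) : mergeGaps j w k = w k := if_pos h

theorem mergeGaps_self (j : ℕ) (w : ℕ → ℕ∞) : mergeGaps j w j = min (w j) (w (j + 1)) := by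
  simp [mergeGaps]

theorem mergeGaps_of_gt {j k : ℕ} (w : ℕ → ℕ∞) (h : j < k) : mergeGaps j w k = w (k + 1) := by
  rw [mergeGaps, if_neg (by omega), if_neg (by omega)]

theorem mergeGaps_add {j n : ℕ} (h : n ≤ j) (w : ℕ → ℕ∞) (k : ℕ) :
    mergeGaps j w (k + n) = mergeGaps (j - n) (fun k => w (k + n)) k := by
  simp only [mergeGaps, show k + n < j ↔ k < j - n by omega, show k + n = j ↔ k = j - n by omega,
    show j - n + n = j by omega, show j - n + 1 + n = j + 1 by omega,
    show k + 1 + n = k + n + 1 by omega]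

theorem lt_mergeGaps {j n k : ℕ} {w : ℕ → ℕ∞} {m : ℕ∞} (h : ∀ k, 0 < k → k < n + 1 → m < w k)
    (h0 : 0 < k) (hk : k < n) : m < mergeGaps j w k := by
  unfold mergeGaps
  split_ifs with h1 h2
  · exact h k h0 (by omega)
  · subst h2
    exact lt_min (h _ h0 (by omega)) (h _ (by omega) (by omega))
  · exact h _ (by omega) (by omega)

/-- A deletion in the tree to the left of `f` merely shifts the gaps of `f`, unless it hits the last
leaf of that tree. The gap in front of `f` then merges with one that is not lower, so its height
stays `m`. The alternative `w 0 = m` covers a one-leaf tree that vanishes. -/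
theorem PForest.HasGaps.mergeGaps_last {f : PForest} {m : ℕ∞} {w : ℕ → ℕ∞} {j n : ℕ} (hj : j < n + 1)
    (h : f.HasGaps m (fun k => w (k + (n + 1)))) (hm : ∀ k, 0 < k → k < n + 1 → m < w k)
    (h0 : 0 < n ∨ w 0 = m) :
    f.HasGaps m (fun k => mergeGaps j w (k + n)) := by
  have hz := h.zero
  refine h.congr fun k _ => ?_
  rcases lt_or_ge j (k + n) with h1 | h1
  · rw [mergeGaps_of_gt _ h1, add_assoc]
  · obtain ⟨rfl, rfl⟩ : k = 0 ∧ n = j := by omega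
    simp only [zero_add] at hz ⊢
    rw [mergeGaps_self, hz, min_eq_right]
    rcases h0 with h0 | h0
    · exact (hm _ h0 (by omega)).le
    · rcases Nat.eq_zero_or_pos n with rfl | hn
      · exact h0.ge
      · exact (hm _ hn (by omega)).le

mutual
-- Once leaf `j` is gone, its neighbours separate at the lower of the two vertices at which they
-- separated from it. A contracted vertex just drops out: only the relative order of heights
-- matters, so they need no renumbering.
theorem PTree.HasGaps.delete? : ∀ {t t' : PTree} {w : ℕ → ℕ∞} {j : ℕ}, t.HasGaps w →
    j < t.leaves → t.delete? j = some t' → t'.HasGaps (mergeGaps j w)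
  | .leaf, t', w, j, _, _, e => by simp [PTree.delete?] at e
  | .node t f, t', w, j, h, hj, e => by
    obtain ⟨m, h1, h2, h3⟩ := h
    have ht := t.leaves_pos
    simp only [PTree.leaves] at hj
    simp only [PTree.delete?] at e
    split_ifs at e with hjt
    · rcases e1 : t.delete? j with _ | t1 <;> rw [e1] at e <;> simp only [Option.some.injEq] at e <;>
        subst e
      · have l := PTree.leaves_of_delete?_none hjt e1
        rw [l] at h3
        obtain rfl : j = 0 := by omega
        refine h3.join.congr fun k hk _ => mergeGaps_of_gt _ hk
      · have l := PTree.leaves_of_delete? hjt e1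
        have := t1.leaves_pos
        rw [← l] at h2 h3
        exact ⟨m, h1.delete? hjt e1, fun k => lt_mergeGaps h2,
          h3.mergeGaps_last (by omega) h2 (Or.inl (by omega))⟩
    · rcases e1 : f.delete? (j - t.leaves) with _ | f1 <;> rw [e1] at e <;>
        simp only [Option.some.injEq] at e <;> subst e
      · exact h1.congr fun k _ h => mergeGaps_of_lt _ (by omega)
      · refine ⟨m, h1.congr fun k _ h => mergeGaps_of_lt _ (by omega), fun k hk hk' => ?_, ?_⟩
        · rw [mergeGaps_of_lt _ (by omega)]
          exact h2 k hk hk'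
        · exact (h3.delete? (by omega) e1).congr fun k _ => mergeGaps_add (by omega) _ _
theorem PForest.HasGaps.delete? : ∀ {f f' : PForest} {m : ℕ∞} {w : ℕ → ℕ∞} {j : ℕ}, f.HasGaps m w →
    j < f.leaves → f.delete? j = some f' → f'.HasGaps m (mergeGaps j w)
  | .single t, f', m, w, j, h, hj, e => by
    obtain ⟨h0, h1, h2⟩ := h
    simp only [PForest.leaves] at hj
    simp only [PForest.delete?] at e
    rcases e1 : t.delete? j with _ | t1 <;> rw [e1] at e <;>
      simp only [Option.some.injEq, reduceCtorEq] at e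
    subst e
    have l := PTree.leaves_of_delete? hj e1
    have := t1.leaves_pos
    rw [← l] at h2
    refine ⟨?_, h1.delete? hj e1, fun k => lt_mergeGaps h2⟩
    rcases Nat.eq_zero_or_pos j with rfl | hj'
    · rw [mergeGaps_self, h0, min_eq_left (h2 _ (by omega) (by omega)).le]
    · rw [mergeGaps_of_lt _ hj', h0]
  | .cons t f, f', m, w, j, h, hj, e => by
    have hle := h.le
    obtain ⟨h0, h1, h2, h3⟩ := h
    have ht := t.leaves_pos
    have hf := f.leaves_pos
    have hz : mergeGaps j w 0 = m := by
      rcases Nat.eq_zero_or_pos j with rfl | hj'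
      · rw [mergeGaps_self, h0, min_eq_left]
        exact hle _ (by simp only [PForest.leaves]; omega)
      · rw [mergeGaps_of_lt _ hj', h0]
    simp only [PForest.leaves] at hj
    simp only [PForest.delete?] at e
    split_ifs at e with hjt
    · rcases e1 : t.delete? j with _ | t1 <;> rw [e1] at e <;> simp only [Option.some.injEq] at e <;>
        subst e
      · have l := PTree.leaves_of_delete?_none hjt e1
        rw [l] at h2 h3
        -- Here `t` vanishes, and the gaps before and after it, both of height `m`, merge.
        exact h3.mergeGaps_last (n := 0) (by omega) h2 (Or.inr h0)
      · have l := PTree.leaves_of_delete? hjt e1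
        have := t1.leaves_pos
        rw [← l] at h2 h3
        exact ⟨hz, h1.delete? hjt e1, fun k => lt_mergeGaps h2,
          h3.mergeGaps_last (by omega) h2 (Or.inl (by omega))⟩
    · rcases e1 : f.delete? (j - t.leaves) with _ | f1 <;> rw [e1] at e <;>
        simp only [Option.some.injEq] at e <;> subst e
      · refine ⟨hz, h1.congr fun k _ h => mergeGaps_of_lt _ (by omega), fun k hk hk' => ?_⟩
        rw [mergeGaps_of_lt _ (by omega)]
        exact h2 k hk hk'
      · refine ⟨hz, h1.congr fun k _ h => mergeGaps_of_lt _ (by omega), fun k hk hk' => ?_, ?_⟩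
        · rw [mergeGaps_of_lt _ (by omega)]
          exact h2 k hk hk'
        · exact (h3.delete? (by omega) e1).congr fun k _ => mergeGaps_add (by omega) _ _
end

/-! ### Operations in terms of gap sequences -/

/-- The operation symbol that compares two gaps. -/
def TriOp.cmp {L : Type*} [LinearOrder L] (a b : L) : TriOp :=
  if a < b then .dashv else if b < a then .vdash else .perp

theorem TriOp.cmp_lt {L : Type*} [LinearOrder L] {a b : L} (h : a < b) :
    TriOp.cmp a b = .dashv := if_pos h

theorem TriOp.cmp_gt {L : Type*} [LinearOrder L] {a b : L} (h : b < a) :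
    TriOp.cmp a b = .vdash := by
  rw [TriOp.cmp, if_neg h.not_gt, if_pos h]

theorem TriOp.cmp_eq {L : Type*} [LinearOrder L] {a b : L} (h : a = b) :
    TriOp.cmp a b = .perp := by
  rw [TriOp.cmp, if_neg h.not_lt, if_neg h.not_gt]

theorem triRel_cmp {L : Type*} [LinearOrder L] (a b c : L) :
    TriRel (TriOp.cmp a b) (TriOp.cmp (min a b) c) (TriOp.cmp a (min b c)) (TriOp.cmp b c) := by
  rcases lt_trichotomy a b with h1 | rfl | h1
  · rw [min_eq_left h1.le, TriOp.cmp_lt h1]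
    rcases lt_trichotomy b c with h2 | rfl | h2
    · rw [min_eq_left h2.le, TriOp.cmp_lt h2, TriOp.cmp_lt (h1.trans h2), TriOp.cmp_lt h1]
      exact .r1
    · rw [min_self, TriOp.cmp_lt h1, TriOp.cmp_eq rfl]
      exact .r6
    · rw [min_eq_right h2.le, TriOp.cmp_gt h2]
      rcases lt_trichotomy a c with h3 | rfl | h3
      · rw [TriOp.cmp_lt h3]
        exact .r2
      · rw [TriOp.cmp_eq rfl]
        exact .r8
      · rw [TriOp.cmp_gt h3]
        exact .r4
  · rw [min_self, TriOp.cmp_eq rfl]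
    rcases lt_trichotomy a c with h2 | rfl | h2
    · rw [min_eq_left h2.le, TriOp.cmp_lt h2, TriOp.cmp_eq rfl]
      exact .r7
    · rw [min_self, TriOp.cmp_eq rfl]
      exact .r11
    · rw [min_eq_right h2.le, TriOp.cmp_gt h2]
      exact .r10
  · rw [min_eq_right h1.le, TriOp.cmp_gt h1]
    rcases lt_trichotomy b c with h2 | rfl | h2
    · rw [min_eq_left h2.le, TriOp.cmp_lt h2, TriOp.cmp_gt h1]
      exact .r3
    · rw [min_self, TriOp.cmp_gt h1, TriOp.cmp_eq rfl]
      exact .r9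
    · rw [min_eq_right h2.le, TriOp.cmp_gt h2, TriOp.cmp_gt (h2.trans h1)]
      exact .r5

mutual
-- Both gaps at a leaf belong to vertices on its path to the root, and the higher one is the vertex
-- right underneath. The leaf is leftmost, rightmost or middle there according to which gap is
-- higher, or whether they agree. The hypotheses on the end entries describe a subtree placed
-- between two lower gaps.
theorem PTree.HasGaps.orient : ∀ {t : PTree} {w : ℕ → ℕ∞}, t.HasGaps w → t ≠ .leaf →
    (∀ k, 0 < k → k < t.leaves → w 0 < w k) → (∀ k, 0 < k → k < t.leaves → w t.leaves < w k) →
    ∀ i, i < t.leaves → t.orient i = TriOp.cmp (w i) (w (i + 1))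
  | .leaf, _, _, hne, _, _, _, _ => absurd rfl hne
  | .node .leaf g, w, h, _, hl, hr, i, hi => by
    obtain ⟨m, h1, h2, h3⟩ := h
    have hg := g.leaves_pos
    simp only [PTree.leaves] at hl hr hi h2 h3
    simp only [PTree.orient]
    split_ifs with h0 <;> simp only [PTree.leaves] at h0 ⊢
    · obtain rfl : i = 0 := by omega
      rw [TriOp.cmp_lt]
      exact hl _ (by omega) (by omega)
    · have hm : w 1 = m := h3.zero
      have := h3.orient (by rw [add_comm, ← hm]; exact hr _ (by omega) (by omega)) (i - 1) (by omega)
      rwa [show i - 1 + 1 = i by omega] at this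
  | .node (.node s s') g, w, h, _, hl, hr, i, hi => by
    obtain ⟨m, h1, h2, h3⟩ := h
    have hg := g.leaves_pos
    have hs := (PTree.node s s').leaves_pos
    have hm := h3.zero
    rw [PTree.leaves] at hl hr hi
    rw [PTree.orient]
    split_ifs with h0
    · refine h1.orient (by simp) (fun k hk hk' => hl k hk (by omega)) (fun k hk hk' => ?_) i h0
      have := h2 k hk hk'
      rw [← hm, zero_add] at this
      exact this
    · have := h3.orient (by
        rw [← hm, add_comm, zero_add]; exact hr _ (by omega) (by omega))
          (i - (PTree.node s s').leaves) (by omega)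
      rwa [show i - (PTree.node s s').leaves + 1 + (PTree.node s s').leaves = i + 1 by omega,
        show i - (PTree.node s s').leaves + (PTree.node s s').leaves = i by omega] at this
theorem PForest.HasGaps.orient : ∀ {f : PForest} {m : ℕ∞} {w : ℕ → ℕ∞}, f.HasGaps m w →
    w f.leaves < m → ∀ i, i < f.leaves → f.orient i = TriOp.cmp (w i) (w (i + 1))
  | .single .leaf, m, w, h, hr, i, hi => by
    simp only [PForest.leaves, PTree.leaves] at hi hr
    obtain rfl : i = 0 := by omega
    rw [TriOp.cmp_gt (by rwa [h.zero])]
    rfl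
  | .single (.node s g), m, w, h, hr, i, hi => by
    obtain ⟨h0, h1, h2⟩ := h
    rw [PForest.leaves] at hi hr
    rw [PForest.orient]
    exact h1.orient (by simp) (fun k hk hk' => by rw [h0]; exact h2 k hk hk')
      (fun k hk hk' => hr.trans (h2 k hk hk')) i hi
  | .cons .leaf g, m, w, h, hr, i, hi => by
    obtain ⟨h0, h1, h2, h3⟩ := h
    have hm := h3.zero
    simp only [PForest.leaves, PTree.leaves] at hi hr h3 hm
    simp only [PForest.orient]
    split_ifs with hi' <;> simp only [PTree.leaves] at hi' ⊢
    · obtain rfl : i = 0 := by omega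
      rw [TriOp.cmp_eq]
      rw [h0, hm]
    · have := h3.orient (by rwa [add_comm]) (i - 1) (by omega)
      rwa [show i - 1 + 1 = i by omega] at this
  | .cons (.node s s') g, m, w, h, hr, i, hi => by
    obtain ⟨h0, h1, h2, h3⟩ := h
    have hm := h3.zero
    rw [PForest.leaves] at hi hr
    rw [PForest.orient]
    split_ifs with hi'
    · refine h1.orient (by simp) (fun k hk hk' => by rw [h0]; exact h2 k hk hk')
        (fun k hk hk' => ?_) i hi'
      have := h2 k hk hk'
      rw [← hm, zero_add] at this
      exact this
    · have := h3.orient (by rwa [add_comm]) (i - (PTree.node s s').leaves) (by omega)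
      rwa [show i - (PTree.node s s').leaves + 1 + (PTree.node s s').leaves = i + 1 by omega,
        show i - (PTree.node s s').leaves + (PTree.node s s').leaves = i by omega] at this
end

/-- A gap sequence of a tree with finite positive entries. -/
structure PTree.IsGapSeq (t : PTree) (w : ℕ → ℕ∞) : Prop where
  hasGaps : t.HasGaps w
  pos : ∀ k, 0 < k → k < t.leaves → 0 < w k
  lt_top : ∀ k, 0 < k → k < t.leaves → w k < ⊤

theorem PTree.exists_isGapSeq (t : PTree) : ∃ w, t.IsGapSeq w := by
  obtain ⟨w, hw, h⟩ := t.exists_hasGaps 0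
  exact ⟨_, hw, fun k _ _ => by exact_mod_cast h k, fun k _ _ => ENat.natCast_lt_top _⟩

theorem mergeGaps_lt_top {j n k : ℕ} {w : ℕ → ℕ∞} (h : ∀ k, 0 < k → k < n + 1 → w k < ⊤)
    (h0 : 0 < k) (hk : k < n) : mergeGaps j w k < ⊤ := by
  unfold mergeGaps
  split_ifs with h1 h2
  · exact h k h0 (by omega)
  · exact (min_le_left _ _).trans_lt (h _ (by omega) (by omega))
  · exact h _ (by omega) (by omega)

theorem PTree.IsGapSeq.del {t : PTree} {w : ℕ → ℕ∞} (h : t.IsGapSeq w) {j : ℕ}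
    (h2 : 2 ≤ t.leaves) (hj : j < t.leaves) : (t.del j).IsGapSeq (mergeGaps j w) where
  hasGaps := h.hasGaps.delete? hj (PTree.delete?_eq_some h2 hj)
  pos k h0 hk := lt_mergeGaps (by rw [PTree.leaves_del h2 hj]; exact h.pos) h0 hk
  lt_top k h0 hk := mergeGaps_lt_top (by rw [PTree.leaves_del h2 hj]; exact h.lt_top) h0 hk

theorem PTree.IsGapSeq.orient {t : PTree} {w : ℕ → ℕ∞} (h : t.IsGapSeq w) {i : ℕ} (h0 : 0 < i)
    (hi : i + 1 < t.leaves) : t.orient i = TriOp.cmp (w i) (w (i + 1)) := by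
  rcases t with _ | ⟨s, g⟩
  · simp [PTree.leaves] at hi
  generalize ht : PTree.node s g = t at h hi ⊢
  -- The end entries of `w` are arbitrary. Setting them to 0, below all gaps by positivity, makes
  -- the recursive lemma applicable to the whole tree.
  set v : ℕ → ℕ∞ := fun k => if 0 < k ∧ k < t.leaves then w k else 0 with hv
  have hv' : ∀ k, 0 < k → k < t.leaves → v k = w k := fun k h h' => if_pos ⟨h, h'⟩
  have e0 : v 0 = 0 := by simp [hv]
  have e1 : v t.leaves = 0 := by simp [hv]
  have hp : ∀ k, 0 < k → k < t.leaves → 0 < v k := fun k h1 h2 => by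
    rw [hv' k h1 h2]; exact h.pos k h1 h2
  have := (h.hasGaps.congr hv').orient (by simp [← ht]) (by rwa [e0]) (by rwa [e1]) i (by omega)
  rwa [hv' _ h0 (by omega), hv' _ (by omega) hi] at this

theorem inf_Ico_le (w : ℕ → ℕ∞) {a b k : ℕ} (h : a ≤ k) (h' : k < b) :
    (Finset.Ico a b).inf w ≤ w k :=
  Finset.inf_le (Finset.mem_Ico.2 ⟨h, h'⟩)

/-- The infimum detects the root. Gap 1 lies above the root exactly if the leftmost subtree is
nontrivial; otherwise it is a root gap, and a later gap has the same height exactly if there are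
more than two children. For two leaves the infimum is empty, hence `⊤`. -/
theorem PTree.IsGapSeq.opFirst {t : PTree} {w : ℕ → ℕ∞} (h : t.IsGapSeq w) (hn : 2 ≤ t.leaves) :
    t.opFirst = TriOp.cmp (w 1) ((Finset.Ico 2 t.leaves).inf w) := by
  rcases t with _ | ⟨s, g⟩
  · simp [PTree.leaves] at hn
  have ht := h.lt_top
  obtain ⟨m, h1, h2, h3⟩ := h.hasGaps
  have hs := s.leaves_pos
  have hg := g.leaves_pos
  have hm := h3.zero
  rw [zero_add] at hm
  simp only [PTree.leaves] at ht hn ⊢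
  rw [PTree.opFirst]
  split_ifs with hd hl <;> simp only [PTree.degree] at hd
  · rw [TriOp.cmp_gt]
    refine (inf_Ico_le w (k := s.leaves) (by omega) (by omega)).trans_lt ?_
    rw [hm]
    exact h2 1 (by omega) (by omega)
  all_goals
    have hs1 : s.leaves = 1 := by omega
    rw [hs1] at hm h3 ht ⊢
  · rw [TriOp.cmp_lt]
    -- Strictness needs `w 1` finite, since the interval may be empty.
    rw [Finset.lt_inf_iff (ht 1 (by omega) (by omega))]
    intro k hk
    rw [Finset.mem_Ico] at hk
    cases g with
    | cons _ f => cases f <;> simp [PForest.length] at hl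
    | single u =>
      have := h3.2.2 (k - 1) (by omega) (by simp only [PForest.leaves] at hk; omega)
      dsimp only at this
      rwa [Nat.sub_add_cancel (by omega), ← hm] at this
  · rw [TriOp.cmp_eq]
    cases g with
    | single u => simp [PForest.length] at hl
    | cons u f =>
      have hu := u.leaves_pos
      have hf := f.leaves_pos
      have h4 := h3.2.2.2.zero
      refine le_antisymm ?_ ?_
      · refine Finset.le_inf fun k hk => ?_
        rw [Finset.mem_Ico] at hk
        have := h3.le (k - 1) (by omega)
        rwa [Nat.sub_add_cancel (by omega), ← hm] at this
      · rw [hm, ← h4]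
        exact inf_Ico_le w (by omega) (by simp only [PForest.leaves]; omega)

theorem PForest.HasGaps.lt_last : ∀ {f : PForest} {m : ℕ∞} {w : ℕ → ℕ∞}, f.HasGaps m w →
    0 < f.last.degree → m < w (f.leaves - 1)
  | .single t, m, w, h, hd => by
    simp only [PForest.last, PTree.degree] at hd
    simp only [PForest.leaves]
    exact h.2.2 _ hd (by omega)
  | .cons t f, m, w, h, hd => by
    have hf := f.leaves_pos
    have := h.2.2.2.lt_last hd
    simp only [PForest.leaves]
    rwa [show f.leaves - 1 + t.leaves = t.leaves + f.leaves - 1 by omega] at this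

theorem PForest.HasGaps.last_eq : ∀ {f : PForest} {m : ℕ∞} {w : ℕ → ℕ∞}, f.HasGaps m w →
    ¬ 0 < f.last.degree → w (f.leaves - 1) = m
  | .single t, m, w, h, hd => by
    simp only [PForest.last, PTree.degree] at hd
    have := t.leaves_pos
    simp only [PForest.leaves]
    rw [show t.leaves - 1 = 0 by omega, h.zero]
  | .cons t f, m, w, h, hd => by
    have hf := f.leaves_pos
    have := h.2.2.2.last_eq hd
    simp only [PForest.leaves]
    rwa [show f.leaves - 1 + t.leaves = t.leaves + f.leaves - 1 by omega] at this

theorem PForest.two_le_leaves_of_degree_last : ∀ {f : PForest}, 0 < f.last.degree → 2 ≤ f.leaves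
  | .single t, h => by
    simp only [PForest.last, PTree.degree] at h
    simp only [PForest.leaves]
    omega
  | .cons t f, h => by
    have := t.leaves_pos
    have := f.leaves_pos
    simp only [PForest.leaves]
    omega

theorem PTree.IsGapSeq.opLast {t : PTree} {w : ℕ → ℕ∞} (h : t.IsGapSeq w) (hn : 2 ≤ t.leaves) :
    t.opLast = TriOp.cmp ((Finset.Ico 1 (t.leaves - 1)).inf w) (w (t.leaves - 1)) := by
  rcases t with _ | ⟨s, g⟩
  · simp [PTree.leaves] at hn
  have ht := h.lt_top
  obtain ⟨m, h1, h2, h3⟩ := h.hasGaps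
  have hs := s.leaves_pos
  have hg := g.leaves_pos
  have hm := h3.zero
  rw [zero_add] at hm
  simp only [PTree.leaves] at ht hn ⊢
  rw [PTree.opLast]
  split_ifs with hd hl
  · have hg2 := PForest.two_le_leaves_of_degree_last hd
    rw [TriOp.cmp_lt]
    refine (inf_Ico_le w (k := s.leaves) (by omega) (by omega)).trans_lt ?_
    have := h3.lt_last hd
    rwa [hm, show s.leaves + g.leaves - 1 = g.leaves - 1 + s.leaves by omega]
  · have he := h3.last_eq hd
    rw [show g.leaves - 1 + s.leaves = s.leaves + g.leaves - 1 by omega] at he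
    rw [TriOp.cmp_gt]
    rw [Finset.lt_inf_iff (ht _ (by omega) (by omega)), he]
    intro k hk
    rw [Finset.mem_Ico] at hk
    refine h2 k (by omega) ?_
    cases g with
    | cons _ f => cases f <;> simp [PForest.length] at hl
    | single u =>
      simp only [PForest.last, PTree.degree] at hd
      simp only [PForest.leaves] at hk
      omega
  · have he := h3.last_eq hd
    rw [show g.leaves - 1 + s.leaves = s.leaves + g.leaves - 1 by omega] at he
    rw [TriOp.cmp_eq]
    cases g with
    | single u => simp [PForest.length] at hl
    | cons u f =>
      have hu := u.leaves_pos
      have hf := f.leaves_pos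
      rw [he]
      refine le_antisymm ?_ ?_
      · rw [← hm]
        exact inf_Ico_le w (by omega) (by simp only [PForest.leaves]; omega)
      · refine Finset.le_inf fun k hk => ?_
        rw [Finset.mem_Ico] at hk
        by_cases hks : k < s.leaves
        · exact (h2 k (by omega) hks).le
        · have := h3.le (k - s.leaves) (by omega)
          rwa [Nat.sub_add_cancel (by omega)] at this

/-- The operation `∘_i` of a tree, with `i` a natural number. -/
def PTree.op (t : PTree) (i : ℕ) : TriOp :=
  if i = 0 then t.opFirst else if i + 1 = t.leaves then t.opLast else t.orient i


theorem PTree.IsGapSeq.op_zero {t : PTree} {w : ℕ → ℕ∞} (h : t.IsGapSeq w) {n : ℕ}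
    (hn : t.leaves = n + 2) : t.op 0 = TriOp.cmp (w 1) ((Finset.Ico 2 (n + 2)).inf w) := by
  rw [PTree.op, if_pos rfl, h.opFirst (by omega), hn]

theorem PTree.IsGapSeq.op_last {t : PTree} {w : ℕ → ℕ∞} (h : t.IsGapSeq w) {n : ℕ}
    (hn : t.leaves = n + 2) :
    t.op (n + 1) = TriOp.cmp ((Finset.Ico 1 (n + 1)).inf w) (w (n + 1)) := by
  rw [PTree.op, if_neg (by omega), if_pos (by omega), h.opLast (by omega), hn]
  rfl

theorem PTree.IsGapSeq.op_of_lt {t : PTree} {w : ℕ → ℕ∞} (h : t.IsGapSeq w) {i : ℕ} (h0 : 0 < i)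
    (hi : i + 1 < t.leaves) : t.op i = TriOp.cmp (w i) (w (i + 1)) := by
  rw [PTree.op, if_neg h0.ne', if_neg hi.ne, h.orient h0 hi]

-- Infima of gaps after a deletion

theorem inf_mergeGaps_of_le {a b j : ℕ} (w : ℕ → ℕ∞) (h : b ≤ j) :
    (Finset.Ico a b).inf (mergeGaps j w) = (Finset.Ico a b).inf w :=
  Finset.inf_congr rfl fun k hk => mergeGaps_of_lt w (by rw [Finset.mem_Ico] at hk; omega)

theorem inf_mergeGaps_of_lt {a b j : ℕ} (w : ℕ → ℕ∞) (h : j < a) :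
    (Finset.Ico a b).inf (mergeGaps j w) = (Finset.Ico (a + 1) (b + 1)).inf w := by
  refine le_antisymm (Finset.le_inf fun k hk => ?_) (Finset.le_inf fun k hk => ?_) <;>
    rw [Finset.mem_Ico] at hk
  · refine (inf_Ico_le _ (k := k - 1) (by omega) (by omega)).trans ?_
    rw [mergeGaps_of_gt w (by omega), Nat.sub_add_cancel (by omega)]
  · rw [mergeGaps_of_gt w (by omega)]
    exact inf_Ico_le _ (by omega) (by omega)

theorem inf_mergeGaps_of_mem {a b j : ℕ} (w : ℕ → ℕ∞) (h : a ≤ j) (h' : j < b) :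
    (Finset.Ico a b).inf (mergeGaps j w) = (Finset.Ico a (b + 1)).inf w := by
  refine le_antisymm (Finset.le_inf fun k hk => ?_) (Finset.le_inf fun k hk => ?_) <;>
    rw [Finset.mem_Ico] at hk
  · rcases lt_trichotomy k j with h1 | rfl | h1
    · refine (inf_Ico_le _ (k := k) (by omega) (by omega)).trans ?_
      rw [mergeGaps_of_lt w h1]
    · refine (inf_Ico_le _ (k := k) (by omega) (by omega)).trans ?_
      rw [mergeGaps_self]
      exact min_le_left _ _
    · refine (inf_Ico_le _ (k := k - 1) (by omega) (by omega)).trans ?_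
      rcases Nat.lt_or_eq_of_le (show j ≤ k - 1 by omega) with h2 | h2
      · rw [mergeGaps_of_gt w h2, Nat.sub_add_cancel (by omega)]
      · rw [← h2, mergeGaps_self, show k = j + 1 by omega]
        exact min_le_right _ _
  · unfold mergeGaps
    split_ifs
    · exact inf_Ico_le _ (by omega) (by omega)
    · exact le_min (inf_Ico_le _ (by omega) (by omega)) (inf_Ico_le _ (by omega) (by omega))
    · exact inf_Ico_le _ (by omega) (by omega)

theorem inf_Ico_eq_min_left {a b : ℕ} (w : ℕ → ℕ∞) (h : a < b) :
    (Finset.Ico a b).inf w = min (w a) ((Finset.Ico (a + 1) b).inf w) := by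
  rw [← Finset.insert_Ico_add_one_left_eq_Ico h, Finset.inf_insert]

theorem inf_Ico_eq_min_right {a b : ℕ} (w : ℕ → ℕ∞) (h : a ≤ b) :
    (Finset.Ico a (b + 1)).inf w = min ((Finset.Ico a b).inf w) (w b) := by
  rw [← Finset.insert_Ico_right_eq_Ico_add_one h, Finset.inf_insert, min_comm]

/-- The three quantities compared are gap 1, gap 2 and the infimum of the later gaps, which is `⊤`
if there are none. -/
theorem PTree.triRel_left {t : PTree} {n : ℕ} (hn : t.leaves = n + 3) :
    TriRel (t.op 1) ((t.del 1).op 0) (t.op 0) ((t.del 0).op 0) := by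
  obtain ⟨w, hw⟩ := t.exists_isGapSeq
  have l0 := PTree.leaves_del (t := t) (i := 0) (by omega) (by omega)
  have l1 := PTree.leaves_del (t := t) (i := 1) (by omega) (by omega)
  rw [hw.op_of_lt (by omega) (by omega), hw.op_zero hn,
    (hw.del (by omega) (by omega)).op_zero (n := n) (by omega),
    (hw.del (by omega) (by omega)).op_zero (n := n) (by omega),
    inf_mergeGaps_of_lt _ (by omega), inf_mergeGaps_of_lt _ (by omega), mergeGaps_self,
    mergeGaps_of_gt _ (by omega), inf_Ico_eq_min_left w (a := 2) (by omega)]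
  exact triRel_cmp _ _ _

theorem PTree.triRel_right {t : PTree} {n : ℕ} (hn : t.leaves = n + 3) :
    TriRel ((t.del (n + 2)).op (n + 1)) (t.op (n + 2))
    ((t.del (n + 1)).op (n + 1)) (t.op (n + 1)) := by
  obtain ⟨w, hw⟩ := t.exists_isGapSeq
  have l0 := PTree.leaves_del (t := t) (i := n + 1) (by omega) (by omega)
  have l1 := PTree.leaves_del (t := t) (i := n + 2) (by omega) (by omega)
  rw [hw.op_of_lt (i := n + 1) (by omega) (by omega), hw.op_last hn,
    (hw.del (by omega) (by omega)).op_last (n := n) (by omega),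
    (hw.del (by omega) (by omega)).op_last (n := n) (by omega),
    inf_mergeGaps_of_le _ (by omega), inf_mergeGaps_of_le _ (by omega), mergeGaps_self,
    mergeGaps_of_lt _ (by omega), inf_Ico_eq_min_right w (b := n + 1) (by omega)]
  exact triRel_cmp _ _ _

/-- The three quantities are the first gap, the infimum of the inner gaps and the last gap. This
supplies the relation in which the cochain value is multiplied from both sides. -/
theorem PTree.triRel_outer {t : PTree} {n : ℕ} (hn : t.leaves = n + 3) :
    TriRel ((t.del (n + 2)).op 0) (t.op (n + 2)) (t.op 0) ((t.del 0).op (n + 1)) := by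
  obtain ⟨w, hw⟩ := t.exists_isGapSeq
  have l0 := PTree.leaves_del (t := t) (i := 0) (by omega) (by omega)
  have l1 := PTree.leaves_del (t := t) (i := n + 2) (by omega) (by omega)
  rw [hw.op_zero hn, hw.op_last hn,
    (hw.del (by omega) (by omega)).op_zero (n := n) (by omega),
    (hw.del (by omega) (by omega)).op_last (n := n) (by omega),
    inf_mergeGaps_of_le _ (by omega), inf_mergeGaps_of_lt _ (by omega),
    mergeGaps_of_lt _ (by omega), mergeGaps_of_gt _ (by omega),
    inf_Ico_eq_min_right w (b := n + 2) (by omega), inf_Ico_eq_min_left w (a := 1) (by omega)]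
  exact triRel_cmp _ _ _

/-- The three quantities are the consecutive gaps `i`, `i + 1`, `i + 2`. -/
theorem PTree.triRel_mid {t : PTree} {n : ℕ} (hn : t.leaves = n + 3) {i : ℕ}
    (h0 : 0 < i) (hi : i ≤ n) :
    TriRel (t.op i) ((t.del i).op i) ((t.del (i + 1)).op i) (t.op (i + 1)) := by
  obtain ⟨w, hw⟩ := t.exists_isGapSeq
  have l0 := PTree.leaves_del (t := t) (i := i) (by omega) (by omega)
  have l1 := PTree.leaves_del (t := t) (i := i + 1) (by omega) (by omega)
  rw [hw.op_of_lt h0 (by omega), hw.op_of_lt (i := i + 1) (by omega) (by omega),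
    (hw.del (j := i) (by omega) (by omega)).op_of_lt h0 (by omega),
    (hw.del (j := i + 1) (by omega) (by omega)).op_of_lt h0 (by omega),
    mergeGaps_self, mergeGaps_self, mergeGaps_of_lt w (Nat.lt_succ_self i),
    mergeGaps_of_gt w (Nat.lt_succ_self i)]
  exact triRel_cmp _ _ _

/-- An inner symbol sees only its two adjacent gaps, and an infimum does not notice two of its terms
being replaced by their minimum. The excluded case is the first symbol when the last leaf is
deleted: a gap then leaves the infimum and the symbol can change, which is where
`PTree.triRel_outer` takes over. -/
theorem PTree.op_del_of_lt {t : PTree} {n : ℕ} (hn : t.leaves = n + 3) {i j : ℕ}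
    (hij : i < j) (hj : j ≤ n ∨ 0 < i ∧ j ≤ n + 1) :
    (t.del (j + 1)).op i = t.op i := by
  obtain ⟨w, hw⟩ := t.exists_isGapSeq
  have l := PTree.leaves_del (t := t) (i := j + 1) (by omega) (by omega)
  rcases Nat.eq_zero_or_pos i with rfl | h0
  · rw [hw.op_zero hn, (hw.del (by omega) (by omega)).op_zero (n := n) (by omega),
      mergeGaps_of_lt _ (by omega), inf_mergeGaps_of_mem _ (by omega) (by omega)]
  · rw [hw.op_of_lt h0 (by omega), (hw.del (by omega) (by omega)).op_of_lt h0 (by omega),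
      mergeGaps_of_lt _ (by omega), mergeGaps_of_lt _ (by omega)]

theorem PTree.op_del_of_gt {t : PTree} {n : ℕ} (hn : t.leaves = n + 3) {i j : ℕ}
    (h0 : 0 < i ∨ j ≤ n) (hij : i < j) (hj : j ≤ n + 1) :
    (t.del i).op j = t.op (j + 1) := by
  obtain ⟨w, hw⟩ := t.exists_isGapSeq
  have l := PTree.leaves_del (t := t) (i := i) (by omega) (by omega)
  rcases Nat.lt_or_eq_of_le hj with h | rfl
  · rw [hw.op_of_lt (i := j + 1) (by omega) (by omega),
      (hw.del (by omega) (by omega)).op_of_lt (by omega) (by omega),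
      mergeGaps_of_gt _ (by omega), mergeGaps_of_gt _ (by omega)]
  · rw [hw.op_last hn, (hw.del (by omega) (by omega)).op_last (n := n) (by omega),
      mergeGaps_of_gt _ (by omega), inf_mergeGaps_of_mem _ (by omega) (by omega)]

/-! ### The square of the coboundary -/

theorem sum_alternating_eq_zero {R W : Type*} [Ring R] [AddCommGroup W] [Module R W] (G : ℕ → ℕ → W)
    (N : ℕ) (h : ∀ i j, i ≤ j → j < N → G (j + 1) i = G i j) :
    ∑ j ∈ Finset.range (N + 1), (-1 : R) ^ j • ∑ i ∈ Finset.range N, (-1 : R) ^ i • G j i = 0 := by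
  induction N with
  | zero => simp
  | succ N ih =>
    rw [Finset.sum_range_succ, Finset.sum_congr rfl fun j _ => by
      rw [Finset.sum_range_succ, smul_add], Finset.sum_add_distrib,
      ih fun i j hij hj => h i j hij (by omega), zero_add,
      Finset.smul_sum, ← Finset.sum_add_distrib]
    -- The new row `j = N + 1` and the new column `i = N` cancel term by term.
    refine Finset.sum_eq_zero fun i hi => ?_
    rw [Finset.mem_range] at hi
    rw [h i N (by omega) (by omega), smul_smul, smul_smul, pow_succ, mul_neg_one, neg_mul, neg_smul,
      ← pow_add, ← pow_add, add_comm i N, add_neg_cancel]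

section

variable {F : Type*} [Field F] {T : Type*} [AddCommGroup T] [Module F T]
  {V : Type*} [AddCommGroup V] [Module F V]

theorem TreeDeg.op_eq {n : ℕ} (i : Fin (n + 2)) (ψ : TreeDeg (n + 1)) : ψ.op i = ψ.1.op i := by
  have h := ψ.2
  rw [TreeDeg.op, PTree.op]
  congr 1
  · rw [Fin.ext_iff, Fin.val_zero]
  · congr 1
    rw [Fin.ext_iff, Fin.val_last, h, eq_iff_iff]
    omega

/-- `mergeArgs` for infinite sequences. -/
def mergeSeq (m : T →ₗ[F] T →ₗ[F] T) (α β : Module.End F T) (i : ℕ) (X : ℕ → T) (k : ℕ) : T :=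
  if k < i then α (X k) else if k = i then m (X i) (X (i + 1)) else β (X (k + 1))

theorem mergeArgs_eq_mergeSeq (m : T →ₗ[F] T →ₗ[F] T) (α β : Module.End F T) {n : ℕ} (i : Fin n)
    (X : ℕ → T) :
    mergeArgs m α β i (fun k => X k) = fun k : Fin n => mergeSeq m α β i X k := by
  funext k
  simp only [mergeArgs, mergeSeq, ← Fin.val_fin_lt, Fin.ext_iff]
  rfl

theorem mergeSeq_of_lt (m : T →ₗ[F] T →ₗ[F] T) (α β : Module.End F T) {i k : ℕ} (X : ℕ → T)
    (h : k < i) : mergeSeq m α β i X k = α (X k) := if_pos h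

theorem mergeSeq_self (m : T →ₗ[F] T →ₗ[F] T) (α β : Module.End F T) (i : ℕ) (X : ℕ → T) :
    mergeSeq m α β i X i = m (X i) (X (i + 1)) := by
  simp [mergeSeq]

theorem mergeSeq_of_gt (m : T →ₗ[F] T →ₗ[F] T) (α β : Module.End F T) {i k : ℕ} (X : ℕ → T)
    (h : i < k) : mergeSeq m α β i X k = β (X (k + 1)) := by
  rw [mergeSeq, if_neg (by omega), if_neg (by omega)]

theorem mergeSeq_succ (m : T →ₗ[F] T →ₗ[F] T) (α β : Module.End F T) (i : ℕ) (X : ℕ → T) (k : ℕ) :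
    mergeSeq m α β (i + 1) X (k + 1) = mergeSeq m α β i (fun k => X (k + 1)) k := by
  simp [mergeSeq]

/-- Merges at disjoint places commute; multiplicativity enters because each merge applies `α` or `β`
to the product formed by the other. -/
theorem mergeSeq_mergeSeq_of_lt (m m' : T →ₗ[F] T →ₗ[F] T) {α β : Module.End F T}
    (hc : ∀ x, α (β x) = β (α x)) (hα : ∀ x y, α (m x y) = m (α x) (α y))
    (hβ : ∀ x y, β (m' x y) = m' (β x) (β y)) {i j : ℕ} (hij : i < j) (X : ℕ → T) :
    mergeSeq m α β i (mergeSeq m' α β (j + 1) X) = mergeSeq m' α β j (mergeSeq m α β i X) := by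
  funext k
  rcases lt_trichotomy k i with h | rfl | h
  · rw [mergeSeq_of_lt _ _ _ _ h, mergeSeq_of_lt _ _ _ _ (show k < j + 1 by omega),
      mergeSeq_of_lt _ _ _ _ (h.trans hij), mergeSeq_of_lt _ _ _ _ h]
  · rw [mergeSeq_self, mergeSeq_of_lt _ _ _ _ (show k < j + 1 by omega),
      mergeSeq_of_lt _ _ _ _ (show k + 1 < j + 1 by omega), mergeSeq_of_lt _ _ _ _ hij,
      mergeSeq_self, hα]
  · rw [mergeSeq_of_gt _ _ _ _ h]
    rcases lt_trichotomy k j with h' | rfl | h'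
    · rw [mergeSeq_of_lt _ _ _ _ (show k + 1 < j + 1 by omega), mergeSeq_of_lt _ _ _ _ h',
        mergeSeq_of_gt _ _ _ _ h, hc]
    · rw [mergeSeq_self, mergeSeq_self, mergeSeq_of_gt _ _ _ _ h,
        mergeSeq_of_gt _ _ _ _ (show i < k + 1 by omega), hβ]
    · rw [mergeSeq_of_gt _ _ _ _ (show j + 1 < k + 1 by omega), mergeSeq_of_gt _ _ _ _ h',
        mergeSeq_of_gt _ _ _ _ (show i < k + 1 by omega)]

theorem mergeSeq_mergeSeq_self (m₁ m₂ m₃ m₄ : T →ₗ[F] T →ₗ[F] T) {α β : Module.End F T}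
    (h : ∀ x y z, m₂ (m₁ x y) (β z) = m₃ (α x) (m₄ y z)) (i : ℕ) (X : ℕ → T) :
    mergeSeq m₃ α β i (mergeSeq m₄ α β (i + 1) X) =
      mergeSeq m₂ α β i (mergeSeq m₁ α β i X) := by
  funext k
  rcases lt_trichotomy k i with hk | rfl | hk
  · rw [mergeSeq_of_lt _ _ _ _ hk, mergeSeq_of_lt _ _ _ _ (show k < i + 1 by omega),
      mergeSeq_of_lt _ _ _ _ hk, mergeSeq_of_lt _ _ _ _ hk]
  · rw [mergeSeq_self, mergeSeq_of_lt _ _ _ _ (Nat.lt_succ_self k), mergeSeq_self, mergeSeq_self,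
      mergeSeq_self, mergeSeq_of_gt _ _ _ _ (Nat.lt_succ_self k), h]
  · rw [mergeSeq_of_gt _ _ _ _ hk, mergeSeq_of_gt _ _ _ _ (show i + 1 < k + 1 by omega),
      mergeSeq_of_gt _ _ _ _ hk, mergeSeq_of_gt _ _ _ _ (show i < k + 1 by omega)]

-- The powers `φ^{n-1}`, with the inverse of `φ` for `n = 0`

theorem predPow_apply_self {φ : Module.End F T} {n : ℕ} (h : n = 0 → IsUnit φ) (x : T) :
    predPow φ n (φ x) = predPow φ (n + 1) x := by
  cases n with
  | zero =>
    have := LinearMap.congr_fun (Ring.inverse_mul_cancel _ (h rfl)) x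
    simpa [predPow] using this
  | succ n => simp [predPow, pow_succ]

theorem apply_predPow {φ : Module.End F T} {n : ℕ} (h : n = 0 → IsUnit φ) (x : T) :
    φ (predPow φ n x) = predPow φ (n + 1) x := by
  rw [← predPow_apply_self h, predPow_commute (Commute.refl φ)]

theorem predPow_map_mul {φ : Module.End F T} (m : T →ₗ[F] T →ₗ[F] T)
    (hm : ∀ x y, φ (m x y) = m (φ x) (φ y)) {n : ℕ} (h : n = 0 → IsUnit φ) (x y : T) :
    predPow φ n (m x y) = m (predPow φ n x) (predPow φ n y) := by
  cases n with
  | zero =>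
    -- The inverse of `φ` is multiplicative because `φ` is: both arguments are written as images
    -- under `φ`.
    have e : ∀ x, φ (predPow φ 0 x) = x := fun x => by rw [apply_predPow h]; rfl
    conv_lhs => rw [← e x, ← e y, ← hm]
    rw [predPow_apply_self h]
    rfl
  | succ n =>
    simp only [predPow]
    induction n with
    | zero => rfl
    | succ n ih => simp only [pow_succ', Module.End.mul_apply, ih (by simp), hm]

/-- A family of multilinear maps, evaluated at arbitrary trees and infinite sequences. -/
noncomputable def seqEval {n : ℕ} (f : TreeDeg n → MultilinearMap F (fun _ : Fin n => T) V)
    (t : PTree) (X : ℕ → T) : V :=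
  open Classical in if h : t.leaves = n + 1 then f ⟨t, h⟩ fun k => X k else 0

theorem seqEval_coe {n : ℕ} (f : TreeDeg n → MultilinearMap F (fun _ : Fin n => T) V)
    (ψ : TreeDeg n) (X : ℕ → T) : seqEval f ψ.1 X = f ψ fun k => X k :=
  dif_pos ψ.2

-- Faces of cochains and the presimplicial identities

namespace MultBiHomTrialgebra

variable (S : MultBiHomTrialgebra F T) (M : S.toBiHomTrialgebra.Mod V)

/-- The `i`-th summand, up to sign, of the coboundary in degree `n`. -/
noncomputable def face (n : ℕ) (f : PTree → (ℕ → T) → V) (t : PTree) (i : ℕ) (X : ℕ → T) : V :=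
  if i = 0 then M.left (t.op 0) (predPow S.α n (X 0)) (f (t.del 0) fun k => X (k + 1))
  else if i = n + 1 then M.right (t.op (n + 1)) (f (t.del (n + 1)) X) (predPow S.β n (X n))
  else f (t.del i) (mergeSeq (S.op (t.op i)) S.α S.β (i - 1) X)

theorem face_zero (n : ℕ) (f : PTree → (ℕ → T) → V) (t : PTree) (X : ℕ → T) :
    S.face M n f t 0 X =
      M.left (t.op 0) (predPow S.α n (X 0)) (f (t.del 0) fun k => X (k + 1)) :=
  if_pos rfl

theorem face_last (n : ℕ) (f : PTree → (ℕ → T) → V) (t : PTree) (X : ℕ → T) :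
    S.face M n f t (n + 1) X =
      M.right (t.op (n + 1)) (f (t.del (n + 1)) X) (predPow S.β n (X n)) := by
  simp [face]

theorem face_succ {n i : ℕ} (h : i < n) (f : PTree → (ℕ → T) → V) (t : PTree) (X : ℕ → T) :
    S.face M n f t (i + 1) X =
      f (t.del (i + 1)) (mergeSeq (S.op (t.op (i + 1))) S.α S.β i X) := by
  rw [face, if_neg (by omega), if_neg (by omega), Nat.add_sub_cancel]

theorem face_sum {ι : Type*} (s : Finset ι) (c : ι → F) (n : ℕ) (f : ι → PTree → (ℕ → T) → V)
    (t : PTree) (j : ℕ) (X : ℕ → T) :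
    S.face M n (fun t X => ∑ i ∈ s, c i • f i t X) t j X = ∑ i ∈ s, c i • S.face M n (f i) t j X := by
  simp only [face]
  split_ifs <;> simp [LinearMap.sum_apply]

/-- A face evaluates its argument only at trees with one leaf less, so the default value of
`seqEval` in wrong degrees does no harm. -/
theorem face_congr {n : ℕ} {f g : PTree → (ℕ → T) → V}
    (h : ∀ (t : PTree), t.leaves = n + 1 → ∀ X, f t X = g t X) {t : PTree} (ht : t.leaves = n + 2)
    {j : ℕ} (hj : j < n + 2) (X : ℕ → T) : S.face M n f t j X = S.face M n g t j X := by
  have hl : ∀ i, i < n + 2 → (t.del i).leaves = n + 1 := fun i hi => by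
    have := PTree.leaves_del (t := t) (i := i) (by omega) (by omega)
    omega
  simp only [face]
  rw [h _ (hl 0 (by omega)), h _ (hl (n + 1) (by omega)), h _ (hl j hj)]

theorem seqEval_coboundaryFormula {n : ℕ}
    (f : TreeDeg n → MultilinearMap F (fun _ : Fin n => T) V) (ψ : TreeDeg (n + 1))
    (X : ℕ → T) : seqEval (S.coboundaryFormula M f) ψ.1 X =
      ∑ i ∈ Finset.range (n + 2), (-1 : F) ^ i • S.face M n (seqEval f) ψ.1 i X := by
  have e : ∀ (i : Fin (n + 2)) (Y : ℕ → T),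
      seqEval f (ψ.1.del i) Y = f (ψ.d i) fun k => Y k := fun i => seqEval_coe f (ψ.d i)
  have e0 := e 0
  have e1 := e (Fin.last (n + 1))
  rw [Fin.val_zero] at e0
  rw [Fin.val_last] at e1
  rw [seqEval_coe, Finset.sum_range_succ, Finset.sum_range_succ', face_zero, face_last, e0, e1,
    Finset.sum_range]
  simp only [coboundaryFormula, add_apply, sum_apply, smul_apply, leftTerm_apply, rightTerm_apply,
    midTerm_apply, LinearMap.comp_apply, LinearMap.compl₂_apply, TreeDeg.op_eq, pow_zero, one_smul]
  congr 1
  rw [add_comm]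
  congr 1
  refine Finset.sum_congr rfl fun i _ => ?_
  rw [face_succ _ _ i.2, mergeArgs_eq_mergeSeq]
  exact congrArg _ (e i.succ.castSucc _).symm

/-- Relations are needed when both faces are the first (`assoc_left`), both the last
(`assoc_right`), one of each (`assoc_mid`), or two adjacent merges (`assoc` in `T`). In the
remaining cases the faces act independently. -/
theorem face_face {n : ℕ} (hα : n = 0 → IsUnit S.α) (hβ : n = 0 → IsUnit S.β)
    {f : PTree → (ℕ → T) → V} (hf : ∀ t X Y, (∀ k < n, X k = Y k) → f t X = f t Y)
    (fα : ∀ t X, M.α (f t X) = f t fun k => S.α (X k))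
    (fβ : ∀ t X, M.β (f t X) = f t fun k => S.β (X k))
    {t : PTree} (ht : t.leaves = n + 3) {i j : ℕ} (hij : i ≤ j) (hj : j < n + 2) (X : ℕ → T) :
    S.face M (n + 1) (fun t => S.face M n f t i) t (j + 1) X =
      S.face M (n + 1) (fun t => S.face M n f t j) t i X := by
  have hc : (t.del (j + 1)).del i = (t.del i).del j := PTree.del_comm hij (by omega)
  obtain rfl | ⟨i, rfl⟩ : i = 0 ∨ ∃ k, i = k + 1 := by
    cases i <;> simp
  · rw [face_zero]
    rcases Nat.lt_or_eq_of_le (show j ≤ n + 1 by omega) with h | rfl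
    · rw [face_succ _ _ (by omega), face_zero, hc]
      obtain rfl | ⟨j, rfl⟩ : j = 0 ∨ ∃ k, j = k + 1 := by
        cases j <;> simp
      -- The module relation puts `β` on the value of `f`, and `fβ` moves it to the arguments, where
      -- the merge has put it too.
      · rw [face_zero, mergeSeq_self, predPow_map_mul _ (S.α_op _) hα, ← apply_predPow hα (X 0),
          ← M.assoc_left (PTree.triRel_left ht), fβ]
        simp only [mergeSeq_of_gt _ _ _ X (Nat.succ_pos _)]
      · rw [face_succ _ _ (by omega), mergeSeq_of_lt _ _ _ _ (by omega), predPow_apply_self hα,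
          PTree.op_del_of_lt ht (by omega) (by omega),
          PTree.op_del_of_gt ht (by omega) (by omega) (by omega)]
        simp only [mergeSeq_succ]
    · rw [face_last, face_zero, face_last, hc, ← apply_predPow hβ, ← apply_predPow hα,
        M.assoc_mid (PTree.triRel_outer ht)]
  · have hin : i < n + 1 := by omega
    rw [face_succ _ _ hin]
    rcases Nat.lt_or_eq_of_le (show j ≤ n + 1 by omega) with h | rfl
    · obtain ⟨j, rfl⟩ : ∃ k, j = k + 1 := ⟨j - 1, by omega⟩
      rw [face_succ _ _ (by omega), face_succ _ _ (by omega), face_succ _ _ (by omega), hc]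
      congr 1
      rcases Nat.lt_or_eq_of_le hij with h1 | h1
      · rw [PTree.op_del_of_lt ht (by omega) (by omega),
          PTree.op_del_of_gt ht (by omega) (by omega) (by omega)]
        exact mergeSeq_mergeSeq_of_lt _ _ S.comm (S.α_op _) (S.β_op _) (by omega) X
      · obtain rfl : i = j := by omega
        exact mergeSeq_mergeSeq_self _ _ _ _
          (S.assoc (PTree.triRel_mid ht (i := i + 1) (by omega) (by omega))) i X
    · rw [face_last, face_last]
      rcases Nat.lt_or_eq_of_le (show i ≤ n by omega) with h1 | rfl
      · rw [face_succ _ _ h1, hc, mergeSeq_of_gt _ _ _ _ h1, predPow_apply_self hβ,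
          PTree.op_del_of_lt ht (i := i + 1) (j := n + 1) (by omega) (by omega),
          PTree.op_del_of_gt ht (by omega) (by omega) (by omega)]
      -- The relation puts `α` on the value of `f`, and `fα` moves it inside. The merge agrees with
      -- `α` only on the first entries, and `hf` says that `f` ignores the others.
      · rw [face_last, hc, mergeSeq_self, predPow_map_mul _ (S.β_op _) hβ,
          ← apply_predPow hβ (X (i + 1)), M.assoc_right (PTree.triRel_right ht), fα,
          hf _ _ _ fun k hk => (mergeSeq_of_lt _ _ _ X hk).symm]

theorem δ_comp_δ (n : ℕ) (h : n = 0 → IsUnit S.α ∧ IsUnit S.β) :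
    S.δ M (n + 1) ∘ₗ S.δ M n = 0 := by
  ext f ψ x
  -- Extension by zero to an infinite sequence, so that shifts and merges need no casts between
  -- finite index types.
  obtain ⟨X, hX⟩ : ∃ X : ℕ → T, x = fun k : Fin (n + 2) => X k :=
    ⟨fun k => if h : k < n + 2 then x ⟨k, h⟩ else 0, by funext k; simp⟩
  have e : seqEval (S.coboundaryFormula M (S.coboundaryFormula M f.1)) ψ.1 X = 0 := by
    rw [S.seqEval_coboundaryFormula M _ ψ]
    rw [← sum_alternating_eq_zero (R := F) (fun j i =>
      S.face M (n + 1) (fun t => S.face M n (seqEval f.1) t i) ψ.1 j X) (n + 2) fun i j hij hj =>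
        S.face_face M (fun h0 => (h h0).1) (fun h0 => (h h0).2) ?_ ?_ ?_ ψ.2 hij hj X]
    · refine Finset.sum_congr rfl fun j hj => ?_
      rw [Finset.mem_range] at hj
      rw [← face_sum]
      congr 1
      exact S.face_congr M (fun t ht Y => S.seqEval_coboundaryFormula M f.1 ⟨t, ht⟩ Y) ψ.2 hj X
    · intro t X Y hXY
      simp only [seqEval]
      split_ifs
      · congr 1
        funext k
        exact hXY k k.2
      · rfl
    · intro t X
      simp only [seqEval]
      split_ifs
      · exact (f.2 _ _).1
      · exact map_zero _
    · intro t X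
      simp only [seqEval]
      split_ifs
      · exact (f.2 _ _).2
      · exact map_zero _
  rw [seqEval_coe, ← hX] at e
  exact e

end MultBiHomTrialgebra

end

/-! ### Corollas -/

/-- The list of `n + 1` trivial trees. -/
def PForest.leafList : ℕ → PForest
  | 0 => .single .leaf
  | n + 1 => .cons .leaf (leafList n)

theorem PForest.leaves_leafList (n : ℕ) : (PForest.leafList n).leaves = n + 1 := by
  induction n with
  | zero => rfl
  | succ n ih => rw [leafList, leaves, ih, PTree.leaves, add_comm]

theorem PForest.delete?_leafList {n i : ℕ} (h : i < n + 2) :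
    (PForest.leafList (n + 1)).delete? i = some (PForest.leafList n) := by
  induction n generalizing i with
  | zero =>
    obtain rfl | rfl : i = 0 ∨ i = 1 := by omega
    · rfl
    · rfl
  | succ n ih =>
    rw [leafList, delete?]
    split_ifs with hi
    · rfl
    · rw [PTree.leaves] at hi ⊢
      rw [ih (by omega)]
      rfl

/-- The corolla with `n + 1` leaves. -/
def TreeDeg.corolla (n : ℕ) : TreeDeg n :=
  ⟨(PForest.leafList n).join, by rw [PForest.leaves_join, PForest.leaves_leafList]⟩

/-- This is what makes evaluation at corollas a chain map. -/
theorem TreeDeg.d_corolla {n : ℕ} (i : Fin (n + 2)) :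
    (TreeDeg.corolla (n + 1)).d i = TreeDeg.corolla n := by
  apply Subtype.ext
  change ((PForest.leafList (n + 1)).join.delete? i).getD .leaf = (PForest.leafList n).join
  rw [PForest.delete?_join, PForest.delete?_leafList i.2]
  rfl

section

variable {F : Type*} [Field F] {T : Type*} [AddCommGroup T] [Module F T]
  {V : Type*} [AddCommGroup V] [Module F V]

/-! ### Induced maps on subquotients -/

/-- The hypothesis `hB'` is injectivity on the quotient; the final clause says that the map is the
one induced by `φ`. -/
theorem exists_subquotient_map {C D : Type*} [AddCommGroup C] [Module F C] [AddCommGroup D]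
    [Module F D] (φ : C →ₗ[F] D) (Z B : Submodule F C) (Z' B' : Submodule F D)
    (hZ : ∀ z ∈ Z, φ z ∈ Z') (hB : ∀ z ∈ B, φ z ∈ B') (hB' : ∀ z ∈ Z, φ z ∈ B' → z ∈ B) :
    ∃ ι : (Z ⧸ B.submoduleOf Z) →ₗ[F] (Z' ⧸ B'.submoduleOf Z'), Function.Injective ι ∧
      ∀ (z : Z) (w : Z'), φ z.1 = w.1 →
        ι (Submodule.Quotient.mk z) = Submodule.Quotient.mk w := by
  have hle : B.submoduleOf Z ≤ (B'.submoduleOf Z').comap (φ.restrict hZ) := fun z hz =>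
    hB z.1 hz
  refine ⟨Submodule.mapQ _ _ (φ.restrict hZ) hle, ?_, fun z w h => ?_⟩
  · rw [injective_iff_map_eq_zero]
    intro q hq
    obtain ⟨z, rfl⟩ := Submodule.Quotient.mk_surjective _ q
    exact (Submodule.Quotient.mk_eq_zero _).2
      (hB' z.1 z.2 ((Submodule.Quotient.mk_eq_zero (B'.submoduleOf Z')).1 hq))
  · obtain rfl : φ.restrict hZ z = w := Subtype.ext h
    rfl

theorem exists_subquotient_equiv {C D : Type*} [AddCommGroup C] [Module F C] [AddCommGroup D]
    [Module F D] (φ : C →ₗ[F] D) (hφ : Function.Surjective φ) (Z B : Submodule F C)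
    (Z' B' : Submodule F D) (hZ : ∀ z, z ∈ Z ↔ φ z ∈ Z') (hB : ∀ z, z ∈ B ↔ φ z ∈ B') :
    ∃ e : (Z ⧸ B.submoduleOf Z) ≃ₗ[F] (Z' ⧸ B'.submoduleOf Z'),
      ∀ (z : Z) (w : Z'), φ z.1 = w.1 →
        e (Submodule.Quotient.mk z) = Submodule.Quotient.mk w := by
  obtain ⟨ι, hι, h⟩ := exists_subquotient_map φ Z B Z' B' (fun z hz => (hZ z).1 hz)
    (fun z hz => (hB z).1 hz) fun z _ hz => (hB z).2 hz
  refine ⟨LinearEquiv.ofBijective ι ⟨hι, fun q => ?_⟩, h⟩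
  obtain ⟨w, rfl⟩ := Submodule.Quotient.mk_surjective _ q
  obtain ⟨z, hz⟩ := hφ w.1
  exact ⟨Submodule.Quotient.mk ⟨z, (hZ z).2 (hz ▸ w.2)⟩, h _ _ hz⟩

theorem MultBiHomTrialgebra.coboundaries_le_cocycles (S : MultBiHomTrialgebra F T)
    (M : S.toBiHomTrialgebra.Mod V) (n : ℕ) : S.coboundaries M n ≤ S.cocycles M n := by
  have key : ∀ n, (n = 0 → IsUnit S.α ∧ IsUnit S.β) →
      LinearMap.range (S.δ M n) ≤ S.cocycles M (n + 1) := fun n h =>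
    LinearMap.range_le_ker_iff.2 (S.δ_comp_δ M n h)
  rcases n with _ | _ | n
  · exact bot_le
  · rw [coboundaries]
    split_ifs with h
    · exact key 0 fun _ => h
    · exact bot_le
  · exact key (n + 1) (by simp)

/-! ### Associative trialgebras -/

namespace AssocTrialgebra

variable (S : AssocTrialgebra F T) (M : S.Mod V)

theorem cochain_toBiHom (n : ℕ) : S.toBiHom.cochain M.toBiHom n = ⊤ :=
  eq_top_iff.2 fun _ _ _ _ => ⟨rfl, rfl⟩

theorem predPow_one (n : ℕ) : predPow (1 : Module.End F T) n = 1 := by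
  cases n with
  | zero => exact Ring.inverse_one _
  | succ n => exact one_pow n

theorem δ_toBiHom (n : ℕ) (f : S.toBiHom.cochain M.toBiHom n) :
    (S.toBiHom.δ M.toBiHom n f).1 = S.δ M n f.1 := by
  funext ψ
  change S.toBiHom.coboundaryFormula M.toBiHom f.1 ψ = _
  rw [MultBiHomTrialgebra.coboundaryFormula]
  have hα : S.toBiHom.α = 1 := rfl
  have hβ : S.toBiHom.β = 1 := rfl
  rw [hα, hβ, predPow_one]
  rfl

theorem exists_H_equiv (n : ℕ) : ∃ e : S.toBiHom.H M.toBiHom n ≃ₗ[F] S.H M n,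
    ∀ (z : S.toBiHom.cocycles M.toBiHom n) (w : S.cocycles M n), z.1.1 = w.1 →
      e (Submodule.Quotient.mk z) = Submodule.Quotient.mk w := by
  have hsurj : ∀ n, Function.Surjective (S.toBiHom.cochain M.toBiHom n).subtype := fun n f =>
    ⟨⟨f, by rw [cochain_toBiHom]; trivial⟩, rfl⟩
  have hr : ∀ n (z : S.toBiHom.cochain M.toBiHom (n + 1)),
      z ∈ LinearMap.range (S.toBiHom.δ M.toBiHom n) ↔ z.1 ∈ LinearMap.range (S.δ M n) := by
    intro n z
    constructor
    · rintro ⟨f, rfl⟩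
      exact ⟨f.1, (δ_toBiHom S M n f).symm⟩
    · rintro ⟨f, hf⟩
      obtain ⟨g, rfl⟩ := hsurj n f
      exact ⟨g, Subtype.ext ((δ_toBiHom S M n g).trans hf)⟩
  refine exists_subquotient_equiv (S.toBiHom.cochain M.toBiHom n).subtype (hsurj n) _ _ _ _
    (fun z => ?_) fun z => ?_
  · rw [cocycles, MultBiHomTrialgebra.cocycles, LinearMap.mem_ker, LinearMap.mem_ker,
      Submodule.subtype_apply, ← δ_toBiHom, Subtype.ext_iff]
    rfl
  · rcases n with _ | _ | n
    · rw [coboundaries, MultBiHomTrialgebra.coboundaries, Submodule.mem_bot, Submodule.mem_bot,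
        Subtype.ext_iff]
      rfl
    -- The identity is invertible, so coboundaries in degree 1 are indeed the image of `δ⁰`.
    · rw [MultBiHomTrialgebra.coboundaries, if_pos ⟨isUnit_one, isUnit_one⟩]
      exact hr 0 z
    · exact hr (n + 1) z

end AssocTrialgebra

/-! ### BiHom-associative algebras -/

namespace BiHomAlgebra

variable (A : BiHomAlgebra F T) (M : A.Bimod V)

theorem const_injective (n : ℕ) : Function.Injective (A.const M n) := fun _ _ h =>
  Subtype.ext (congrFun (congrArg Subtype.val h) (TreeDeg.corolla n))

/-- The value of a cochain at the corolla. -/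
def atCorolla {n : ℕ} (g : A.toTrialgebra.cochain M.toTrialgebra n) : A.cochain M n :=
  ⟨g.1 (TreeDeg.corolla n), fun x => g.2 (TreeDeg.corolla n) x⟩

theorem mem_range_const {n : ℕ} (g : A.toTrialgebra.cochain M.toTrialgebra n) :
    g ∈ LinearMap.range (A.const M n) ↔ ∀ ψ ψ' : TreeDeg n, g.1 ψ = g.1 ψ' := by
  constructor
  · rintro ⟨f, rfl⟩ ψ ψ'
    rfl
  · intro h
    exact ⟨A.atCorolla M g, Subtype.ext (funext fun ψ => h _ ψ)⟩

/-- All operations coincide, so `ψ` enters the formula only through its faces. The hypothesis holds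
for constant cochains at every tree and for arbitrary cochains at corollas. -/
theorem δ_apply_eq {n : ℕ} (g : A.toTrialgebra.cochain M.toTrialgebra (n + 1))
    (f : A.cochain M (n + 1)) (ψ : TreeDeg (n + 2)) (h : ∀ i, g.1 (ψ.d i) = f.1) :
    (A.toTrialgebra.δ M.toTrialgebra (n + 1) g).1 ψ = (A.δ M n f).1 := by
  ext x
  change A.toTrialgebra.coboundaryFormula M.toTrialgebra g.1 ψ x = coboundaryFormula A M f.1 x
  rw [coboundaryFormula_apply]
  simp only [MultBiHomTrialgebra.coboundaryFormula, add_apply, sum_apply, smul_apply,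
    leftTerm_apply, rightTerm_apply, midTerm_apply, LinearMap.comp_apply, LinearMap.compl₂_apply, h]
  rfl

theorem δ_const (n : ℕ) (f : A.cochain M (n + 1)) :
    A.toTrialgebra.δ M.toTrialgebra (n + 1) (A.const M (n + 1) f) =
      A.const M (n + 2) (A.δ M n f) :=
  Subtype.ext (funext fun ψ => A.δ_apply_eq M _ f ψ fun _ => rfl)

theorem δ_atCorolla {n : ℕ} (g : A.toTrialgebra.cochain M.toTrialgebra (n + 1)) :
    A.δ M n (A.atCorolla M g) = A.atCorolla M (A.toTrialgebra.δ M.toTrialgebra (n + 1) g) :=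
  Subtype.ext (A.δ_apply_eq M g _ _ fun i => by rw [TreeDeg.d_corolla]; rfl).symm

/-- The degree is `n + 2` because the algebra complex has no coboundaries in degree 1, while the
trialgebra complex has those of `δ⁰` if the structure maps are invertible. -/
theorem exists_H_injective (n : ℕ) :
    ∃ ι : A.H M (n + 1) →ₗ[F] A.toTrialgebra.H M.toTrialgebra (n + 2), Function.Injective ι ∧
      ∀ (z : A.cocycles M (n + 1)) (w : A.toTrialgebra.cocycles M.toTrialgebra (n + 2)),
        A.const M (n + 2) z.1 = w.1 →
          ι (Submodule.Quotient.mk z) = Submodule.Quotient.mk w := by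
  refine exists_subquotient_map (A.const M (n + 2)) _ _ _ _ (fun z hz => ?_) (fun z hz => ?_)
    fun z _ hz => ?_
  · rw [MultBiHomTrialgebra.cocycles, LinearMap.mem_ker, δ_const, LinearMap.mem_ker.1 hz, map_zero]
  · obtain ⟨f, rfl⟩ := hz
    exact ⟨A.const M (n + 1) f, A.δ_const M n f⟩
  · obtain ⟨g, hg⟩ := hz
    -- If `g` bounds the constant cochain of `z`, its value at the corolla bounds `z`.
    refine ⟨A.atCorolla M g, ?_⟩
    rw [δ_atCorolla, hg]
    rfl

end BiHomAlgebra

end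

theorem mainTheorem3 {F : Type*} [Field F] {T : Type*} [AddCommGroup T] [Module F T]
    {V : Type*} [AddCommGroup V] [Module F V] :
    -- the cochain complex of a multiplicative BiHom-associative trialgebra
    (∀ (S : MultBiHomTrialgebra F T) (M : S.toBiHomTrialgebra.Mod V),
      (∀ n : ℕ, (n = 0 → IsUnit S.α ∧ IsUnit S.β) → S.δ M (n + 1) ∘ₗ S.δ M n = 0) ∧
      (∀ n : ℕ, S.coboundaries M n ≤ S.cocycles M n)) ∧
    -- specialization to associative trialgebras
    (∀ (S : AssocTrialgebra F T) (M : S.Mod V),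
      (∀ n : ℕ, S.toBiHom.cochain M.toBiHom n = ⊤) ∧
      (∀ (n : ℕ) (f : S.toBiHom.cochain M.toBiHom n),
        (S.toBiHom.δ M.toBiHom n f).1 = S.δ M n f.1) ∧
      (∀ n : ℕ, ∃ e : S.toBiHom.H M.toBiHom n ≃ₗ[F] S.H M n,
        ∀ (z : S.toBiHom.cocycles M.toBiHom n) (w : S.cocycles M n), z.1.1 = w.1 →
          e (Submodule.Quotient.mk z) = Submodule.Quotient.mk w)) ∧
    -- specialization to BiHom-associative algebras
    (∀ (A : BiHomAlgebra F T) (M : A.Bimod V),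
      (∀ n : ℕ, Function.Injective (A.const M n) ∧
        ∀ g : A.toTrialgebra.cochain M.toTrialgebra n,
          g ∈ LinearMap.range (A.const M n) ↔ ∀ ψ ψ' : TreeDeg n, g.1 ψ = g.1 ψ') ∧
      (∀ (n : ℕ) (f : A.cochain M (n + 1)),
        A.toTrialgebra.δ M.toTrialgebra (n + 1) (A.const M (n + 1) f) =
          A.const M (n + 2) (A.δ M n f)) ∧
      (∀ n : ℕ, ∃ ι : A.H M (n + 1) →ₗ[F] A.toTrialgebra.H M.toTrialgebra (n + 2),
        Function.Injective ι ∧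
        ∀ (z : A.cocycles M (n + 1)) (w : A.toTrialgebra.cocycles M.toTrialgebra (n + 2)),
          A.const M (n + 2) z.1 = w.1 →
            ι (Submodule.Quotient.mk z) = Submodule.Quotient.mk w)) := by
  exact ⟨fun S M => ⟨S.δ_comp_δ M, S.coboundaries_le_cocycles M⟩,
    fun S M => ⟨S.cochain_toBiHom M, S.δ_toBiHom M, S.exists_H_equiv M⟩,
    fun A M => ⟨fun n => ⟨A.const_injective M n, A.mem_range_const M⟩, A.δ_const M,
      A.exists_H_injective M⟩⟩
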